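/- Let $\mathbb{T}^d=[0,2\pi]^d$ with opposite faces identified, let $c_k(f)=(2\pi)^{-d}\int_{\mathbb{T}^d}f(x)e^{-ikx}\,dx$ ($k\in\mathbb{Z}^d$), and for $s>0$ let $H^s_{\mathrm{mix}}(\mathbb{T}^d)$ be the space of all $f\in L_2(\mathbb{T}^d)$ with $$\|f\|^{\#}_{H^s_{\mathrm{mix}}}:=\Big[\sum_{k\in\mathbb{Z}^d}|c_k(f)|^2\prod_{j=1}^d(1+|k_j|^2)^s\Big]^{1/2}<\infty .$$ Let $\|f\|_{H^s_{\mathrm{mix}}}:=\big(\sum_{k\in\mathbb{N}_0^d}2^{2s|k|_1}\|\delta_k(f)\|_2^2\big)^{1/2}$ be the Littlewood–Paley norm, where $\delta_k(f)=\sum_{m\in P_{k_1}\times\cdots\times P_{k_d}}c_m(f)e^{imx}$, $P_0=\{0\}$ and $P_j=\{\ell\in\mathbb{Z}:2^{j-1}\le|\ell|<2^j\}$ for $j\ge1$. For $m\in\mathbb{N}$ let $$I_mf(t)=\frac1{2m+1}\sum_{\ell=0}^{2m}f(t^m_\ell)\,D_m(t-t^m_\ell),\qquad t^m_\ell=\frac{2\pi\ell}{2m+1},\qquad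 D_m(t)=\sum_{|k|\le m}e^{ikt},$$ let $\eta_0=I_1$, $\eta_m=I_{2^m}-I_{2^{m-1}}$ for $m\ge1$, $q_k=\eta_{k_1}\otimes\cdots\otimes\eta_{k_d}$ for $k\in\mathbb{N}_0^d$, and $Q_\Delta=\sum_{k\in\Delta}q_k$ for finite $\Delta\subset\mathbb{N}_0^d$. **Theorem.** Let $\gamma>0$ and $\alpha>\max\{\gamma,1/2\}$, and put $\Delta(\xi)=\{k\in\mathbb{N}_0^d:(\alpha-\gamma)|k|_1\le\xi\}$. Then there is a constant $C=C(\alpha,\gamma,d)>0$ such that for all $f\in H^\alpha_{\mathrm{mix}}(\mathbb{T}^d)$ and all $\xi>0$ one has $f-Q_{\Delta(\xi)}f\in H^\gamma_{\mathrm{mix}}(\mathbb{T}^d)$ and $$\|f-Q_{\Delta(\xi)}f\|_{H^\gamma_{\mathrm{mix}}(\mathbb{T}^d)}\le C\,2^{-\xi}\,\|f\|_{H^\alpha_{\mathrm{mix}}(\mathbb{T}^d)},$$ and the same inequality holds with the norms $\|\cdot\|^{\#}$ in place of $\|\cdot\|$. Here $f$ has a continuous representative, and $Q_{\Delta(\xi)}$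 is applied to it. -/

import Mathlib

open MeasureTheory

noncomputable section

namespace SmolyakSampling

instance factTwoPiPos : Fact ((0 : ℝ) < 2 * Real.pi) := ⟨Real.two_pi_pos⟩

/-- The circle `[0, 2π]` with its end points identified, with Lebesgue measure (total mass `2π`). -/
abbrev Circ : Type := AddCircle (2 * Real.pi)

/-- The `d`-dimensional torus `[0, 2π]^d`, with Lebesgue measure (total mass `(2π)^d`). -/
abbrev Torus (d : ℕ) : Type := Fin d → Circ

/-- The exponential `x ↦ e^{i k x}` on the torus (`fourier n t` is `e^{i n t}` on `Circ`). -/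
def expo {d : ℕ} (k : Fin d → ℤ) (x : Torus d) : ℂ := ∏ j, fourier (k j) (x j)

/-- The Fourier coefficient `c_k(f) = (2π)^{-d} ∫ f(x) e^{-ikx} dx`. -/
def coeff {d : ℕ} (f : Torus d → ℂ) (k : Fin d → ℤ) : ℂ :=
  (1 / (2 * Real.pi : ℂ) ^ d) * ∫ x, f x * expo (-k) x

/-! ### Sobolev spaces of dominating mixed smoothness -/

/-- The norm `[∑_{k ∈ ℤ^d} |c_k(f)|² ∏_j (1 + |k_j|²)^s]^{1/2}`, as an element of `[0, ∞]`. -/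
def mixNorm {d : ℕ} (s : ℝ) (f : Torus d → ℂ) : ENNReal :=
  (∑' k : Fin d → ℤ,
    ENNReal.ofReal (‖coeff f k‖ ^ 2 * ∏ j, (1 + (k j : ℝ) ^ 2) ^ s)) ^ (1 / 2 : ℝ)

/-- `f` is a representative of an element of `H^s_mix`: it belongs to `L_2` and has a finite
`H^s_mix` norm. -/
def MemMix {d : ℕ} (s : ℝ) (f : Torus d → ℂ) : Prop :=
  MemLp f 2 volume ∧ mixNorm s f < ⊤

/-- The univariate dyadic blocks `P_0 = {0}`, `P_j = {ℓ ∈ ℤ : 2^{j-1} ≤ |ℓ| < 2^j}` for `j ≥ 1`. -/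
def dyadicBlock : ℕ → Finset ℤ
  | 0 => {0}
  | j + 1 => {l ∈ Finset.Icc (-(2 : ℤ) ^ (j + 1)) ((2 : ℤ) ^ (j + 1)) |
      (2 : ℤ) ^ j ≤ |l| ∧ |l| < (2 : ℤ) ^ (j + 1)}

/-- `δ_k(f) = ∑_{m ∈ P_{k_1} × ⋯ × P_{k_d}} c_m(f) e^{imx}`. -/
def dyadicPart {d : ℕ} (k : Fin d → ℕ) (f : Torus d → ℂ) (x : Torus d) : ℂ :=
  ∑ m ∈ Fintype.piFinset (fun j => dyadicBlock (k j)), coeff f m * expo m x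

/-- The Littlewood-Paley norm `(∑_{k ∈ ℕ_0^d} 2^{2 s |k|_1} ‖δ_k(f)‖_2²)^{1/2}` of `H^s_mix`, as an
element of `[0, ∞]`. -/
def mixNormLP {d : ℕ} (s : ℝ) (f : Torus d → ℂ) : ENNReal :=
  (∑' k : Fin d → ℕ,
    ENNReal.ofReal ((2 : ℝ) ^ (2 * s * ((∑ j, k j : ℕ) : ℝ))) *
      eLpNorm (dyadicPart k f) 2 volume ^ 2) ^ (1 / 2 : ℝ)

/-! ### Sampling operators -/

/-- The Dirichlet kernel `D_m(t) = ∑_{|k| ≤ m} e^{ikt}`. -/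
def dirichlet (m : ℕ) (t : Circ) : ℂ := ∑ k ∈ Finset.Icc (-(m : ℤ)) (m : ℤ), fourier k t

/-- The equidistant node `t^m_ℓ = 2πℓ / (2m+1)`. -/
def node (m l : ℕ) : Circ := ((2 * Real.pi * (l : ℝ) / (2 * (m : ℝ) + 1) : ℝ) : Circ)

/-- Univariate trigonometric interpolation
`I_m f(t) = (2m+1)^{-1} ∑_{ℓ=0}^{2m} f(t^m_ℓ) D_m(t - t^m_ℓ)`. -/
def interp (m : ℕ) (f : Circ → ℂ) (t : Circ) : ℂ :=
  (1 / (2 * (m : ℂ) + 1)) *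
    ∑ l ∈ Finset.range (2 * m + 1), f (node m l) * dirichlet m (t - node m l)

/-- `η_0 = I_1` and `η_m = I_{2^m} - I_{2^{m-1}}` for `m ≥ 1`. -/
def eta : ℕ → (Circ → ℂ) → Circ → ℂ
  | 0, f => interp 1 f
  | m + 1, f => interp (2 ^ (m + 1)) f - interp (2 ^ m) f

/-- The univariate operator `A` acting on the `j`-th variable, the other ones being fixed, that is,
`Id ⊗ ⋯ ⊗ A ⊗ ⋯ ⊗ Id`. -/
def onCoord {d : ℕ} (j : Fin d) (A : (Circ → ℂ) → Circ → ℂ) (f : Torus d → ℂ) (x : Torus d) : ℂ :=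
  A (fun t => f (Function.update x j t)) (x j)

/-- `q_k = η_{k_1} ⊗ ⋯ ⊗ η_{k_d}`: the operators `η_{k_j}` are applied one after the other, each in
its own variable. -/
def q {d : ℕ} (k : Fin d → ℕ) (f : Torus d → ℂ) : Torus d → ℂ :=
  (List.finRange d).foldr (fun j g => onCoord j (eta (k j)) g) f

/-- `Q_Δ = ∑_{k ∈ Δ} q_k`, for a finite set `Δ`. -/
def samplingOp {d : ℕ} (Δ : Set (Fin d → ℕ)) (f : Torus d → ℂ) : Torus d → ℂ :=
  ∑ᶠ k ∈ Δ, q k f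

/-- `Δ(ξ) = {k ∈ ℕ_0^d : (α - γ) |k|_1 ≤ ξ}`. -/
def smolyakSet (d : ℕ) (α γ ξ : ℝ) : Set (Fin d → ℕ) :=
  {k | (α - γ) * ((∑ j, k j : ℕ) : ℝ) ≤ ξ}

/-- The sum that defines the Smolyak operator is a finite one. -/
theorem smolyakSet_finite (d : ℕ) {α γ : ℝ} (h : γ < α) (ξ : ℝ) :
    (smolyakSet d α γ ξ).Finite := by
  refine (Set.finite_Iic (fun _ : Fin d => ⌊ξ / (α - γ)⌋₊)).subset ?_
  intro k hk j
  have h1 : ((∑ j, k j : ℕ) : ℝ) ≤ ξ / (α - γ) := by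
    rw [le_div_iff₀ (sub_pos.2 h), mul_comm]; exact hk
  exact (Finset.single_le_sum (fun i _ => Nat.zero_le (k i)) (Finset.mem_univ j)).trans
    (Nat.le_floor h1)

end SmolyakSampling

end

noncomputable section
namespace SmolyakSampling

/-! ### Exponentials and Fourier coefficients on the torus -/

/-! Everything is read off on Fourier coefficients. As `α > 1/2`, the Fourier series of `f`
converges absolutely and is its continuous representative, and sampling commutes with pointwise
convergent series. So `q_k` acts on coefficients through a matrix, `tensorKernel`, the product of
univariate matrices `blockKernel` that record aliasing modulo `2M+1`.

Interpolation reproduces low frequencies, so for a fixed input frequency `n` only finitely many `k`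
contribute, and the sum over all `k` telescopes to the identity (`exists_sum_tensorKernel_eq`). The
error is therefore carried by the `k` outside `Δ(ξ)`. There `1 ≤ 2^{-ξ} 2^{(α-γ)|k|_1}`; inserting
this factor and then summing absolute values over all `k` leaves `2^{-ξ}` times a product kernel
(`enorm_coeff_sub_samplingOp_le`).

Its boundedness between the weighted `ℓ_2` spaces follows from a Schur test that tensorises
(`tensor_schur_test`), leaving two univariate sums. For fixed output `m`, aliasing gives `∑_n
(1+n²)^{-β/2} |b_k(m,n)| ≲ 2^{-βk}` if `β > 1`, and `|m| ≤ 2^k` makes the sum over `k` geometric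
because `γ > 0`. For fixed input `n`, each column has mass at most 2 and `2^k ≲ (1+n²)^{1/2}`, so
the sum over `k` is geometric for any exponent `θ > 0`. The Littlewood–Paley version follows by
equivalence of norms. -/

theorem continuous_expo {d : ℕ} (k : Fin d → ℤ) : Continuous (expo k) := by
  unfold expo
  fun_prop

/-- The exponentials as bundled continuous maps. -/
def expoC {d : ℕ} (k : Fin d → ℤ) : C(Torus d, ℂ) := ⟨expo k, continuous_expo k⟩

@[simp] theorem expoC_apply {d : ℕ} (k : Fin d → ℤ) (x : Torus d) : expoC k x = expo k x := rfl

@[simp] theorem norm_expo {d : ℕ} (k : Fin d → ℤ) (x : Torus d) : ‖expo k x‖ = 1 := by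
  simp only [expo, norm_prod, fourier_apply, Circle.norm_coe, Finset.prod_const_one]

theorem expo_add {d : ℕ} (k l : Fin d → ℤ) (x : Torus d) :
    expo (k + l) x = expo k x * expo l x := by
  simp [expo, Finset.prod_mul_distrib]

theorem expo_neg {d : ℕ} (k : Fin d → ℤ) (x : Torus d) :
    expo (-k) x = starRingEnd ℂ (expo k x) := by
  simp only [expo, Pi.neg_apply, fourier_neg, map_prod]

theorem expo_zero {d : ℕ} (x : Torus d) : expo 0 x = 1 := by
  simp [expo]

theorem integral_fourier (n : ℤ) :
    ∫ t : Circ, fourier n t = if n = 0 then (2 * Real.pi : ℂ) else 0 := by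
  split_ifs with h
  · subst h
    simp [measureReal_def, AddCircle.measure_univ, Real.pi_pos.le]
  · exact integral_eq_zero_of_add_right_eq_neg (fourier_add_half_inv_index h Real.two_pi_pos)

theorem integral_expo {d : ℕ} (k : Fin d → ℤ) :
    ∫ x, expo k x = if k = 0 then (2 * Real.pi : ℂ) ^ d else 0 := by
  simp only [expo]
  rw [integral_fintype_prod_volume_eq_prod (fun j (t : Circ) => fourier (k j) t)]
  simp only [integral_fourier]
  split_ifs with h
  · simp [h]
  · obtain ⟨j, hj⟩ := Function.ne_iff.mp h
    exact Finset.prod_eq_zero (Finset.mem_univ j) (if_neg hj)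

theorem two_pi_pow_ne_zero (d : ℕ) : (2 * Real.pi : ℂ) ^ d ≠ 0 := by
  simp [Real.pi_ne_zero]

theorem integrable_mul_expo {d : ℕ} {f : Torus d → ℂ} (hf : Integrable f) (k : Fin d → ℤ) :
    Integrable fun x => f x * expo k x :=
  hf.mul_bdd (c := 1) (continuous_expo k).aestronglyMeasurable (.of_forall fun x => by simp)

theorem integrable_of_continuous {d : ℕ} {f : Torus d → ℂ} (hf : Continuous f) : Integrable f :=
  hf.integrable_of_hasCompactSupport (HasCompactSupport.of_compactSpace _)

theorem coeff_expo {d : ℕ} (n m : Fin d → ℤ) : coeff (expo n) m = if n = m then 1 else 0 := by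
  have h := two_pi_pow_ne_zero d
  simp only [coeff, ← expo_add, integral_expo, add_neg_eq_zero]
  split_ifs <;> simp [h]

theorem coeff_sub {d : ℕ} {f g : Torus d → ℂ} (hf : Integrable f) (hg : Integrable g)
    (m : Fin d → ℤ) : coeff (f - g) m = coeff f m - coeff g m := by
  simp only [coeff, Pi.sub_apply, sub_mul]
  rw [integral_sub (integrable_mul_expo hf _) (integrable_mul_expo hg _), mul_sub]

theorem coeff_sum {d : ℕ} {ι : Type*} (s : Finset ι) {f : ι → Torus d → ℂ}
    (hf : ∀ i ∈ s, Integrable (f i)) (m : Fin d → ℤ) :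
    coeff (∑ i ∈ s, f i) m = ∑ i ∈ s, coeff (f i) m := by
  simp only [coeff, Finset.sum_apply, Finset.sum_mul]
  rw [integral_finsetSum _ (fun i hi => integrable_mul_expo (hf i hi) _), Finset.mul_sum]

theorem coeff_const_mul {d : ℕ} (c : ℂ) (f : Torus d → ℂ) (m : Fin d → ℤ) :
    coeff (fun x => c * f x) m = c * coeff f m := by
  simp only [coeff, mul_assoc]
  rw [integral_const_mul]
  ring

theorem continuous_tsum_expo {d : ℕ} {a : (Fin d → ℤ) → ℂ} (ha : Summable fun n => ‖a n‖) :
    Continuous fun x => ∑' n, a n * expo n x :=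
  continuous_tsum (fun n => continuous_const.mul (continuous_expo n)) ha (fun n x => by simp)

theorem summable_mul_expo {d : ℕ} {a : (Fin d → ℤ) → ℂ} (ha : Summable fun n => ‖a n‖)
    (x : Torus d) : Summable fun n => a n * expo n x :=
  Summable.of_norm (by simpa using ha)

theorem coeff_tsum_expo {d : ℕ} {a : (Fin d → ℤ) → ℂ} (ha : Summable fun n => ‖a n‖)
    (m : Fin d → ℤ) : coeff (fun x => ∑' n, a n * expo n x) m = a m := by
  have h1 : ∀ n : Fin d → ℤ, Integrable fun x : Torus d => a n * expo n x * expo (-m) x := fun n =>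
    integrable_mul_expo (integrable_of_continuous (continuous_const.mul (continuous_expo n))) _
  have h2 : ∫ x, (∑' n, a n * expo n x) * expo (-m) x
      = ∑' n, ∫ x, a n * expo n x * expo (-m) x := by
    rw [integral_tsum_of_summable_integral_norm h1]
    · simp only [tsum_mul_right]
    · simpa using ha.mul_left _
  have h3 : ∀ n, (1 / (2 * Real.pi : ℂ) ^ d) * ∫ x, a n * expo n x * expo (-m) x
      = if n = m then a n else 0 := fun n => by
    change coeff (fun x => a n * expo n x) m = _
    rw [coeff_const_mul, coeff_expo]
    simp
  unfold coeff
  rw [h2, ← tsum_mul_left]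
  simp only [h3]
  exact (tsum_eq_single m fun n hn => if_neg hn).trans (if_pos rfl)

/-- The linear span of the exponentials is dense in the space of continuous functions. -/
theorem span_expoC_closure_eq_top (d : ℕ) :
    (Submodule.span ℂ (Set.range (expoC (d := d)))).topologicalClosure = ⊤ := by
  -- Stone–Weierstrass; the exponentials are closed under products and conjugation, so the star
  -- algebra they generate is their linear span.
  let S : StarSubalgebra ℂ C(Torus d, ℂ) :=
    { toSubalgebra := Algebra.adjoin ℂ (Set.range expoC)
      star_mem' := by
        change Algebra.adjoin ℂ (Set.range expoC) ≤ star (Algebra.adjoin ℂ (Set.range expoC))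
        refine Algebra.adjoin_le ?_
        rintro _ ⟨n, rfl⟩
        refine Algebra.subset_adjoin ⟨-n, ?_⟩
        ext1 x
        simp only [expoC_apply, expo_neg, starRingEnd_apply, ContinuousMap.star_apply] }
  have hS : Subalgebra.toSubmodule S.toSubalgebra = Submodule.span ℂ (Set.range expoC) := by
    apply Algebra.adjoin_eq_span_of_subset
    refine .trans (fun x ↦ Submonoid.closure_induction (fun _ ↦ id) ⟨0, ?_⟩ ?_)
      Submodule.subset_span
    · ext z
      simp [expo_zero]
    · rintro _ _ _ _ ⟨m, rfl⟩ ⟨n, rfl⟩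
      refine ⟨m + n, ?_⟩
      ext z
      simp [expo_add]
  have hsep : S.toSubalgebra.SeparatesPoints := by
    intro x y hxy
    obtain ⟨i, hi⟩ := Function.ne_iff.mp hxy
    have hsingle : ∀ z : Torus d, expo (Pi.single i 1) z = fourier 1 (z i) := fun z => by
      unfold expo
      rw [Finset.prod_eq_single i]
      · rw [Pi.single_eq_same]
      · intro j _ hj
        rw [Pi.single_eq_of_ne hj, fourier_zero]
      · simp
    refine ⟨_, ⟨expoC (Pi.single i 1), Algebra.subset_adjoin ⟨Pi.single i 1, rfl⟩, rfl⟩, ?_⟩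
    change expo (Pi.single i 1) x ≠ expo (Pi.single i 1) y
    rw [hsingle, hsingle, fourier_one, fourier_one]
    exact fun h => hi (AddCircle.injective_toCircle Real.two_pi_pos.ne' (Circle.ext h))
  rw [← hS]
  exact congr_arg (Subalgebra.toSubmodule <| StarSubalgebra.toSubalgebra ·)
    (ContinuousMap.starSubalgebra_topologicalClosure_eq_top_of_separatesPoints S hsep)

/-- A square integrable function all of whose Fourier coefficients vanish is zero. -/
theorem ae_eq_zero_of_coeff_eq_zero {d : ℕ} {f : Torus d → ℂ} (hf : MemLp f 2 volume)
    (h : ∀ m, coeff f m = 0) : f =ᵐ[volume] 0 := by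
  let E (n : Fin d → ℤ) : Lp ℂ 2 (volume : Measure (Torus d)) :=
    ContinuousMap.toLp (E := ℂ) 2 volume ℂ (expoC n)
  have hE : (Submodule.span ℂ (Set.range E)).topologicalClosure = ⊤ := by
    simpa only [Submodule.map_span, ContinuousLinearMap.coe_coe, ← Set.range_comp,
      Function.comp_def] using
      (ContinuousMap.toLp_denseRange ℂ volume ℂ
        (ENNReal.ofNat_ne_top (n := 2))).topologicalClosure_map_submodule
        (span_expoC_closure_eq_top d)
  have hin : ∀ n, inner ℂ (E n) (hf.toLp f) = 0 := fun n => by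
    have h1 := h n
    simp only [coeff, mul_eq_zero, one_div, inv_eq_zero, two_pi_pow_ne_zero, false_or] at h1
    rw [L2.inner_def, ← h1]
    refine integral_congr_ae ?_
    filter_upwards [hf.coeFn_toLp, ContinuousMap.coeFn_toLp (p := 2) (𝕜 := ℂ) volume (expoC n)]
      with x hx1 hx2
    rw [hx1, hx2, RCLike.inner_apply, expo_neg, expoC_apply]
  have hzero : hf.toLp f = 0 := by
    rw [Submodule.topologicalClosure_eq_top_iff, Submodule.eq_bot_iff] at hE
    refine hE _ ((Submodule.mem_orthogonal _ _).2 fun u hu => ?_)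
    induction hu using Submodule.span_induction with
    | mem x hx =>
      obtain ⟨n, rfl⟩ := hx
      exact hin n
    | zero => exact inner_zero_left _
    | add x y _ _ hx hy => rw [inner_add_left, hx, hy, add_zero]
    | smul c x _ hx => rw [inner_smul_left, hx, mul_zero]
  exact (hf.coeFn_toLp).symm.trans (by rw [hzero]; exact Lp.coeFn_zero _ _ _)

/-- A square integrable function with absolutely summable Fourier coefficients is represented by
its Fourier series. -/
theorem tsum_expo_ae_eq {d : ℕ} {f : Torus d → ℂ} (hf : MemLp f 2 volume)
    (hs : Summable fun n => ‖coeff f n‖) :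
    (fun x => ∑' n, coeff f n * expo n x) =ᵐ[volume] f := by
  have hc := continuous_tsum_expo hs
  have hg : MemLp (fun x => ∑' n, coeff f n * expo n x) 2 volume :=
    hc.memLp_of_hasCompactSupport (HasCompactSupport.of_compactSpace _)
  have h := ae_eq_zero_of_coeff_eq_zero (hg.sub hf) fun m => by
    rw [coeff_sub (integrable_of_continuous hc) (hf.integrable (by norm_num)), coeff_tsum_expo hs,
      sub_self]
  filter_upwards [h] with x hx
  exact sub_eq_zero.1 hx

/-- Parseval's identity for trigonometric polynomials. -/
theorem eLpNorm_sum_expo_sq {d : ℕ} (s : Finset (Fin d → ℤ)) (a : (Fin d → ℤ) → ℂ) :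
    eLpNorm (fun x => ∑ m ∈ s, a m * expo m x) 2 volume ^ 2
      = ENNReal.ofReal ((2 * Real.pi) ^ d) * ∑ m ∈ s, ‖a m‖ₑ ^ 2 := by
  set P : Torus d → ℂ := fun x => ∑ m ∈ s, a m * expo m x with hP
  have hPc : Continuous P :=
    continuous_finsetSum _ fun m _ => continuous_const.mul (continuous_expo m)
  have hint : ∫ x, P x * starRingEnd ℂ (P x)
      = ((2 * Real.pi : ℂ) ^ d) * ∑ m ∈ s, a m * starRingEnd ℂ (a m) := by
    have h1 : ∀ x, P x * starRingEnd ℂ (P x)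
        = ∑ m ∈ s, ∑ l ∈ s, (a m * starRingEnd ℂ (a l)) * expo (m + -l) x := fun x => by
      simp only [hP, map_sum, map_mul, Finset.sum_mul_sum, expo_add, expo_neg]
      refine Finset.sum_congr rfl fun m _ => Finset.sum_congr rfl fun l _ => by ring
    have hi : ∀ (c : ℂ) (n : Fin d → ℤ), Integrable fun x => c * expo n x := fun c n =>
      integrable_of_continuous (continuous_const.mul (continuous_expo n))
    simp only [h1]
    rw [integral_finsetSum _ fun m _ => integrable_finsetSum _ fun l _ => hi _ _, Finset.mul_sum]
    refine Finset.sum_congr rfl fun m hm => ?_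
    rw [integral_finsetSum _ fun l _ => hi _ _]
    simp only [integral_const_mul, integral_expo, add_neg_eq_zero]
    simp only [mul_ite, mul_zero, Finset.sum_ite_eq, hm, if_true]
    ring
  have hint2 : ∫ x, ‖P x‖ ^ 2 = (2 * Real.pi) ^ d * ∑ m ∈ s, ‖a m‖ ^ 2 := by
    have : ((∫ x, ‖P x‖ ^ 2 : ℝ) : ℂ) = (((2 * Real.pi) ^ d * ∑ m ∈ s, ‖a m‖ ^ 2 : ℝ) : ℂ) := by
      rw [← integral_complex_ofReal]
      push_cast
      simpa only [Complex.mul_conj, Complex.normSq_eq_norm_sq, Complex.ofReal_pow] using hint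
    exact_mod_cast this
  rw [eLpNorm_eq_lintegral_rpow_enorm_toReal (by norm_num) (by norm_num)]
  have h2 : ∫⁻ x, ‖P x‖ₑ ^ (2 : ℝ) = ENNReal.ofReal (∫ x, ‖P x‖ ^ 2) := by
    rw [ofReal_integral_eq_lintegral_ofReal]
    · refine lintegral_congr fun x => ?_
      rw [ENNReal.ofReal_pow (norm_nonneg _), ofReal_norm]
      norm_num
    · exact (hPc.norm.pow 2).integrable_of_hasCompactSupport (HasCompactSupport.of_compactSpace _)
    · exact .of_forall fun x => by positivity
  simp only [ENNReal.toReal_ofNat]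
  rw [h2, hint2, ← ENNReal.rpow_natCast, ← ENNReal.rpow_mul]
  norm_num
  rw [ENNReal.ofReal_mul (by positivity), ENNReal.ofReal_sum_of_nonneg (fun _ _ => by positivity)]
  simp [ENNReal.ofReal_pow]

/-! ### Comparison of the two norms -/

/-- The block index is the binary length of `|n|`, so the blocks partition `ℤ`. -/
theorem mem_dyadicBlock_iff (j : ℕ) (n : ℤ) : n ∈ dyadicBlock j ↔ n.natAbs.size = j := by
  have habs : |n| = (n.natAbs : ℤ) := Int.abs_eq_natAbs n
  cases j with
  | zero => simp [dyadicBlock, Nat.size_eq_zero]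
  | succ j =>
    have h1 : n.natAbs.size = j + 1 ↔ 2 ^ j ≤ n.natAbs ∧ n.natAbs < 2 ^ (j + 1) := by
      rw [← Nat.lt_size, ← Nat.size_le]
      omega
    rw [h1]
    simp only [dyadicBlock, Finset.mem_filter, Finset.mem_Icc]
    have h2 : ((2 : ℤ) ^ j ≤ |n| ↔ 2 ^ j ≤ n.natAbs) := by
      rw [habs]; exact_mod_cast Iff.rfl
    have h3 : (|n| < (2 : ℤ) ^ (j + 1) ↔ n.natAbs < 2 ^ (j + 1)) := by
      rw [habs]; exact_mod_cast Iff.rfl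
    rw [h2, h3]
    refine ⟨fun h => h.2, fun h => ⟨?_, h⟩⟩
    exact abs_le.1 (h3.2 h.2).le

/-- Parseval in each block, then regrouping by frequency. Comparing the two norms becomes comparing
`4 ^ size` with `1 + n²` in each coordinate. -/
theorem mixNormLP_eq {d : ℕ} (s : ℝ) (f : Torus d → ℂ) :
    mixNormLP s f = (∑' m : Fin d → ℤ, ENNReal.ofReal ((2 * Real.pi) ^ d *
      (‖coeff f m‖ ^ 2 * ∏ j, (4 : ℝ) ^ (s * (m j).natAbs.size)))) ^ (1 / 2 : ℝ) := by
  unfold mixNormLP dyadicPart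
  congr 1
  simp only [eLpNorm_sum_expo_sq]
  have h1 : ∀ k : Fin d → ℕ, ENNReal.ofReal ((2 : ℝ) ^ (2 * s * ((∑ j, k j : ℕ) : ℝ))) *
      (ENNReal.ofReal ((2 * Real.pi) ^ d) *
        ∑ m ∈ Fintype.piFinset (fun j => dyadicBlock (k j)), ‖coeff f m‖ₑ ^ 2)
      = ∑' m : Fin d → ℤ, if k = (fun j => (m j).natAbs.size) then
          ENNReal.ofReal ((2 * Real.pi) ^ d *
            (‖coeff f m‖ ^ 2 * ∏ j, (4 : ℝ) ^ (s * (m j).natAbs.size))) else 0 := fun k => by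
    rw [tsum_eq_sum (s := Fintype.piFinset (fun j => dyadicBlock (k j))), Finset.mul_sum,
      Finset.mul_sum]
    · refine Finset.sum_congr rfl fun m hm => ?_
      simp only [Fintype.mem_piFinset, mem_dyadicBlock_iff] at hm
      have hk : k = fun j => (m j).natAbs.size := funext fun j => (hm j).symm
      rw [if_pos hk]
      have h4 : (2 : ℝ) ^ (2 * s * ((∑ j, k j : ℕ) : ℝ))
          = ∏ j, (4 : ℝ) ^ (s * (m j).natAbs.size) := by
        rw [show (4 : ℝ) = 2 ^ (2 : ℝ) by norm_num]
        simp only [← Real.rpow_mul (zero_le_two (α := ℝ))]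
        rw [← Real.rpow_sum_of_pos two_pos, hk]
        push_cast
        rw [Finset.mul_sum]
        simp only [mul_assoc]
      rw [h4, ENNReal.ofReal_mul (by positivity), ENNReal.ofReal_mul (by positivity),
        ENNReal.ofReal_pow (norm_nonneg _), ofReal_norm]
      ring
    · intro m hm
      rw [if_neg]
      contrapose! hm
      simp [hm, mem_dyadicBlock_iff]
  simp only [h1]
  rw [ENNReal.tsum_comm]
  exact tsum_congr fun m => tsum_ite_eq _ _

theorem one_add_sq_le (n : ℤ) : 1 + (n : ℝ) ^ 2 ≤ 4 * 4 ^ n.natAbs.size := by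
  have h : n.natAbs ≤ 2 ^ n.natAbs.size := (Nat.lt_size_self _).le
  have h2 : n.natAbs ^ 2 ≤ (2 ^ n.natAbs.size) ^ 2 := Nat.pow_le_pow_left h 2
  have h3 : (n : ℝ) ^ 2 ≤ 4 ^ n.natAbs.size := by
    have : ((n.natAbs ^ 2 : ℕ) : ℝ) ≤ (((2 ^ n.natAbs.size) ^ 2 : ℕ) : ℝ) := by exact_mod_cast h2
    push_cast at this
    rw [← pow_mul, mul_comm, pow_mul] at this
    norm_num at this
    simpa using this
  have h4 : (1 : ℝ) ≤ 4 ^ n.natAbs.size := one_le_pow₀ (by norm_num)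
  linarith

theorem four_pow_size_le (n : ℤ) : (4 : ℝ) ^ n.natAbs.size ≤ 4 * (1 + (n : ℝ) ^ 2) := by
  rcases Nat.eq_zero_or_pos n.natAbs.size with h | h
  · rw [h]
    nlinarith [sq_nonneg (n : ℝ)]
  · obtain ⟨j, hj⟩ := Nat.exists_eq_succ_of_ne_zero h.ne'
    have h1 : 2 ^ j ≤ n.natAbs := Nat.lt_size.1 (by omega)
    have h2 : (2 ^ j) ^ 2 ≤ n.natAbs ^ 2 := Nat.pow_le_pow_left h1 2
    have h3 : (4 : ℝ) ^ j ≤ (n : ℝ) ^ 2 := by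
      have : (((2 ^ j) ^ 2 : ℕ) : ℝ) ≤ ((n.natAbs ^ 2 : ℕ) : ℝ) := by exact_mod_cast h2
      push_cast at this
      rw [← pow_mul, mul_comm, pow_mul] at this
      norm_num at this
      simpa using this
    rw [hj, pow_succ]
    linarith

theorem rpow_half_le {X Y : ENNReal} {K : ℝ} (hK : 0 ≤ K) (h : X ≤ ENNReal.ofReal (K ^ 2) * Y) :
    X ^ (1 / 2 : ℝ) ≤ ENNReal.ofReal K * Y ^ (1 / 2 : ℝ) := by
  rw [ENNReal.ofReal_pow hK] at h
  refine (ENNReal.rpow_le_rpow h (by norm_num)).trans_eq ?_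
  rw [ENNReal.mul_rpow_of_nonneg _ _ (by norm_num), ← ENNReal.rpow_natCast, ← ENNReal.rpow_mul]
  norm_num

theorem rpow_half_tsum_le {ι : Type*} {u v : ι → ENNReal} {K : ℝ} (hK : 0 ≤ K)
    (h : ∀ i, u i ≤ ENNReal.ofReal (K ^ 2) * v i) :
    (∑' i, u i) ^ (1 / 2 : ℝ) ≤ ENNReal.ofReal K * (∑' i, v i) ^ (1 / 2 : ℝ) :=
  rpow_half_le hK (by rw [← ENNReal.tsum_mul_left]; exact ENNReal.tsum_le_tsum h)

theorem exists_mixNormLP_le (d : ℕ) {s : ℝ} (hs : 0 ≤ s) :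
    ∃ K : ℝ, 0 < K ∧ ∀ f : Torus d → ℂ, mixNormLP s f ≤ ENNReal.ofReal K * mixNorm s f := by
  refine ⟨Real.sqrt ((2 * Real.pi) ^ d * ((4 : ℝ) ^ s) ^ d), by positivity, fun f => ?_⟩
  rw [mixNormLP_eq]
  refine rpow_half_tsum_le (by positivity) fun m => ?_
  rw [← ENNReal.ofReal_mul (by positivity), Real.sq_sqrt (by positivity), mul_assoc]
  refine ENNReal.ofReal_le_ofReal (mul_le_mul_of_nonneg_left ?_ (by positivity))
  rw [mul_left_comm]
  refine mul_le_mul_of_nonneg_left ?_ (by positivity)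
  have hc : ((4 : ℝ) ^ s) ^ d = ∏ _j : Fin d, (4 : ℝ) ^ s := by simp
  rw [hc, ← Finset.prod_mul_distrib]
  refine Finset.prod_le_prod (fun _ _ => by positivity) fun j _ => ?_
  rw [← Real.mul_rpow (by norm_num) (by positivity), mul_comm s, Real.rpow_mul (by norm_num),
    Real.rpow_natCast]
  exact Real.rpow_le_rpow (by positivity) (four_pow_size_le _) hs

theorem exists_mixNorm_le (d : ℕ) {s : ℝ} (hs : 0 ≤ s) :
    ∃ K : ℝ, 0 < K ∧ ∀ f : Torus d → ℂ, mixNorm s f ≤ ENNReal.ofReal K * mixNormLP s f := by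
  refine ⟨Real.sqrt (((2 * Real.pi) ^ d)⁻¹ * ((4 : ℝ) ^ s) ^ d), by positivity, fun f => ?_⟩
  rw [mixNormLP_eq]
  refine rpow_half_tsum_le (by positivity) fun m => ?_
  rw [← ENNReal.ofReal_mul (by positivity), Real.sq_sqrt (by positivity)]
  refine ENNReal.ofReal_le_ofReal ?_
  have hc : ((4 : ℝ) ^ s) ^ d = ∏ _j : Fin d, (4 : ℝ) ^ s := by simp
  have hpos : (2 * Real.pi) ^ d ≠ 0 := by positivity
  have hrw : ∀ P : ℝ, ((2 * Real.pi) ^ d)⁻¹ * ((4 : ℝ) ^ s) ^ d *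
      ((2 * Real.pi) ^ d * (‖coeff f m‖ ^ 2 * P)) = ‖coeff f m‖ ^ 2 * (((4 : ℝ) ^ s) ^ d * P) := by
    intro P
    field_simp
  rw [hrw]
  refine mul_le_mul_of_nonneg_left ?_ (by positivity)
  rw [hc, ← Finset.prod_mul_distrib]
  refine Finset.prod_le_prod (fun _ _ => by positivity) fun j _ => ?_
  rw [mul_comm s, Real.rpow_mul (by norm_num), Real.rpow_natCast,
    ← Real.mul_rpow (by norm_num) (by positivity)]
  exact Real.rpow_le_rpow (by positivity) (one_add_sq_le _) hs

/-! ### Action of the sampling operators on Fourier series -/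

/-- The kernel that describes the aliasing of interpolation at `2 M + 1` equidistant nodes: the
coefficient of `e^{imt}` in the interpolant of `e^{int}`. -/
def aliasKernel (M : ℕ) (m n : ℤ) : ℂ :=
  if |m| ≤ (M : ℤ) ∧ (2 * M + 1 : ℤ) ∣ n - m then 1 else 0

/-- The kernel of `η_j` with respect to the exponentials. -/
def blockKernel : ℕ → ℤ → ℤ → ℂ
  | 0, m, n => aliasKernel 1 m n
  | j + 1, m, n => aliasKernel (2 ^ (j + 1)) m n - aliasKernel (2 ^ j) m n

/-- The kernel of `q_k` with respect to the exponentials. -/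
def tensorKernel {d : ℕ} (k : Fin d → ℕ) (m n : Fin d → ℤ) : ℂ :=
  ∏ j, blockKernel (k j) (m j) (n j)

/-- At the nodes `e^{ipt}` runs through the powers of one `(2M+1)`-th root of unity, so this is a
geometric sum. -/
theorem sum_fourier_node (M : ℕ) (p : ℤ) :
    ∑ l ∈ Finset.range (2 * M + 1), fourier p (node M l)
      = if (2 * M + 1 : ℤ) ∣ p then (2 * M + 1 : ℂ) else 0 := by
  have hN : (2 * (M : ℂ) + 1) ≠ 0 := by exact_mod_cast (Nat.succ_ne_zero (2 * M))
  set ζ : ℂ := Complex.exp (2 * Real.pi * Complex.I * p / (2 * M + 1)) with hζ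
  have h1 : ∀ l : ℕ, fourier p (node M l) = ζ ^ l := fun l => by
    rw [node, fourier_coe_apply, hζ, ← Complex.exp_nat_mul]
    congr 1
    have : (Real.pi : ℂ) ≠ 0 := by exact_mod_cast Real.pi_ne_zero
    push_cast
    field_simp
  have h2 : ζ = 1 ↔ (2 * M + 1 : ℤ) ∣ p := by
    rw [hζ, Complex.exp_eq_one_iff]
    constructor
    · rintro ⟨n, hn⟩
      refine ⟨n, ?_⟩
      rw [div_eq_iff hN] at hn
      have h3 : (2 * Real.pi * Complex.I) * (p : ℂ)
          = (2 * Real.pi * Complex.I) * ((2 * M + 1) * n) := by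
        rw [hn]; ring
      exact_mod_cast mul_left_cancel₀ Complex.two_pi_I_ne_zero h3
    · rintro ⟨n, rfl⟩
      refine ⟨n, ?_⟩
      push_cast
      field_simp
  have h3 : ζ ^ (2 * M + 1) = 1 := by
    rw [hζ, ← Complex.exp_nat_mul, Complex.exp_eq_one_iff]
    refine ⟨p, ?_⟩
    push_cast
    field_simp
  simp only [h1]
  split_ifs with h
  · rw [h2.2 h]
    simp
  · rw [geom_sum_eq (fun h4 => h (h2.1 h4)), h3]
    simp

/-- The kernel vanishes for `|m| > M`, hence the freedom in `s`; it lets both interpolants in `eta`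
be written over one range. -/
theorem interp_fourier (M : ℕ) (n : ℤ) {s : Finset ℤ} (hs : Finset.Icc (-(M : ℤ)) M ⊆ s)
    (t : Circ) :
    interp M (fourier n) t = ∑ m ∈ s, aliasKernel M m n * fourier m t := by
  have hN : (2 * (M : ℂ) + 1) ≠ 0 := by exact_mod_cast (Nat.succ_ne_zero (2 * M))
  have h1 : ∀ (m : ℤ) (u : Circ),
      fourier n u * fourier m (t - u) = fourier m t * fourier (n - m) u := fun m u => by
    have h2 : fourier m (t - u) = fourier m t * fourier (-m) u := by
      simp only [fourier_apply, sub_eq_add_neg, zsmul_add, zsmul_neg, neg_zsmul,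
        AddCircle.toCircle_add, Circle.coe_mul]
    rw [h2, sub_eq_add_neg, fourier_add]
    ring
  unfold interp dirichlet
  simp only [Finset.mul_sum, h1]
  rw [Finset.sum_comm]
  simp only [← Finset.mul_sum, sum_fourier_node]
  rw [Finset.mul_sum, ← Finset.sum_subset hs]
  · refine Finset.sum_congr rfl fun m hm => ?_
    rw [Finset.mem_Icc] at hm
    unfold aliasKernel
    by_cases h : (2 * M + 1 : ℤ) ∣ n - m
    · rw [if_pos h, if_pos ⟨abs_le.2 hm, h⟩]
      field_simp
    · rw [if_neg h, if_neg (fun h' => h h'.2)]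
      simp
  · intro m _ hm
    rw [Finset.mem_Icc] at hm
    rw [aliasKernel, if_neg (fun h' => hm (abs_le.1 h'.1)), zero_mul]

theorem eta_fourier (j : ℕ) (n : ℤ) (t : Circ) :
    eta j (fourier n) t
      = ∑ m ∈ Finset.Icc (-(2 : ℤ) ^ j) (2 ^ j), blockKernel j m n * fourier m t := by
  cases j with
  | zero =>
    rw [eta, interp_fourier 1 n (s := Finset.Icc (-(2 : ℤ) ^ 0) (2 ^ 0)) (by simp)]
    rfl
  | succ j =>
    rw [eta, Pi.sub_apply,
      interp_fourier (2 ^ (j + 1)) n (s := Finset.Icc (-(2 : ℤ) ^ (j + 1)) (2 ^ (j + 1)))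
        (by simp),
      interp_fourier (2 ^ j) n (s := Finset.Icc (-(2 : ℤ) ^ (j + 1)) (2 ^ (j + 1)))
        (by
          have : (2 : ℤ) ^ j ≤ 2 ^ (j + 1) := pow_le_pow_right₀ (by norm_num) (by omega)
          push_cast
          exact Finset.Icc_subset_Icc (by omega) this),
      ← Finset.sum_sub_distrib]
    refine Finset.sum_congr rfl fun m _ => ?_
    rw [blockKernel, sub_mul]

/-- Only finitely many point values enter, so pointwise convergence is enough. -/
theorem hasSum_interp {ι : Type*} (M : ℕ) {F : ι → Circ → ℂ} {G : Circ → ℂ}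
    (h : ∀ t, HasSum (fun i => F i t) (G t)) (t : Circ) :
    HasSum (fun i => interp M (F i) t) (interp M G t) :=
  (hasSum_sum fun l _ => (h (node M l)).mul_right (dirichlet M (t - node M l))).mul_left _

theorem hasSum_eta {ι : Type*} (j : ℕ) {F : ι → Circ → ℂ} {G : Circ → ℂ}
    (h : ∀ t, HasSum (fun i => F i t) (G t)) (t : Circ) :
    HasSum (fun i => eta j (F i) t) (eta j G t) := by
  cases j with
  | zero => exact hasSum_interp 1 h t
  | succ j => exact (hasSum_interp _ h t).sub (hasSum_interp _ h t)

theorem interp_const_mul (M : ℕ) (c : ℂ) (f : Circ → ℂ) (t : Circ) :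
    interp M (fun u => c * f u) t = c * interp M f t := by
  simp only [interp, mul_assoc, ← Finset.mul_sum]
  ring

theorem eta_const_mul (j : ℕ) (c : ℂ) (f : Circ → ℂ) (t : Circ) :
    eta j (fun u => c * f u) t = c * eta j f t := by
  cases j with
  | zero => exact interp_const_mul 1 c f t
  | succ j => simp only [eta, Pi.sub_apply, interp_const_mul, mul_sub]

theorem hasSum_q {d : ℕ} {ι : Type*} (k : Fin d → ℕ) {F : ι → Torus d → ℂ} {G : Torus d → ℂ}
    (h : ∀ x, HasSum (fun i => F i x) (G x)) (x : Torus d) :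
    HasSum (fun i => q k (F i) x) (q k G x) := by
  unfold q
  induction List.finRange d generalizing x with
  | nil => exact h x
  | cons j L ih => exact hasSum_eta (k j) (fun t => ih (Function.update x j t)) (x j)

/-- Stated for a partial list so that induction applies: `L` holds the coordinates already treated,
and `Nodup` ensures that the next one is still untouched. -/
theorem foldr_onCoord_prod {d : ℕ} (k : Fin d → ℕ) (c : ℂ) (φ : Fin d → Circ → ℂ)
    {L : List (Fin d)} (hL : L.Nodup) (x : Torus d) :
    L.foldr (fun j g => onCoord j (eta (k j)) g) (fun y => c * ∏ j, φ j (y j)) x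
      = c * ∏ j, (if j ∈ L then eta (k j) (φ j) else φ j) (x j) := by
  induction L generalizing x with
  | nil => simp
  | cons i L ih =>
    obtain ⟨hi, hL⟩ := List.nodup_cons.1 hL
    rw [List.foldr_cons, onCoord]
    simp only [ih hL]
    have h1 : ∀ t, c * ∏ j, (if j ∈ L then eta (k j) (φ j) else φ j) (Function.update x i t j)
        = (c * ∏ j ∈ Finset.univ.erase i, (if j ∈ L then eta (k j) (φ j) else φ j) (x j))
          * φ i t := fun t => by
      rw [← Finset.mul_prod_erase _ _ (Finset.mem_univ i), if_neg hi, Function.update_self,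
        mul_left_comm, mul_comm]
      congr 2
      refine Finset.prod_congr rfl fun j hj => ?_
      rw [Function.update_of_ne (Finset.ne_of_mem_erase hj)]
    simp only [h1]
    rw [eta_const_mul, ← Finset.mul_prod_erase _ _ (Finset.mem_univ i),
      if_pos List.mem_cons_self, mul_assoc, mul_comm (eta _ _ _)]
    congr 2
    refine Finset.prod_congr rfl fun j hj => ?_
    simp [Finset.ne_of_mem_erase hj]

/-- The frequencies of the trigonometric polynomials in the range of `q_k`. -/
def freqBox {d : ℕ} (k : Fin d → ℕ) : Finset (Fin d → ℤ) :=
  Fintype.piFinset fun j => Finset.Icc (-(2 : ℤ) ^ k j) (2 ^ k j)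

theorem q_const_mul_expo {d : ℕ} (k : Fin d → ℕ) (c : ℂ) (n : Fin d → ℤ) (x : Torus d) :
    q k (fun y => c * expo n y) x
      = ∑ m ∈ freqBox k, c * tensorKernel k m n * expo m x := by
  unfold q expo
  rw [foldr_onCoord_prod k c (fun j => fourier (n j)) (List.nodup_finRange d)]
  simp only [List.mem_finRange, if_true, eta_fourier]
  rw [Finset.prod_univ_sum, Finset.mul_sum]
  refine Finset.sum_congr rfl fun m _ => ?_
  rw [Finset.prod_mul_distrib, mul_assoc]
  rfl

theorem aliasKernel_eq_zero {M : ℕ} {m n : ℤ} (h : (M : ℤ) < |m|) : aliasKernel M m n = 0 :=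
  if_neg fun h' => absurd h'.1 (not_le.2 h)

/-- Interpolation reproduces degree `M`: `|n - m| ≤ 2M` is too small for a nonzero multiple of
`2M+1`. -/
theorem aliasKernel_of_abs_le {M : ℕ} {m n : ℤ} (h : |n| ≤ M) :
    aliasKernel M m n = if m = n then 1 else 0 := by
  unfold aliasKernel
  congr 1
  refine propext ⟨fun ⟨h1, h2⟩ => ?_, fun h1 => ⟨h1 ▸ h, by simp [h1]⟩⟩
  have h3 : n - m = 0 := by
    refine Int.eq_zero_of_abs_lt_dvd h2 ?_
    rw [abs_le] at h h1
    rw [abs_lt]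
    constructor <;> omega
  omega

theorem blockKernel_eq_zero_of_lt {j : ℕ} {m n : ℤ} (h : (2 : ℤ) ^ j < |m|) :
    blockKernel j m n = 0 := by
  cases j with
  | zero => exact aliasKernel_eq_zero (by simpa using h)
  | succ j =>
    have : (2 : ℤ) ^ j ≤ 2 ^ (j + 1) := pow_le_pow_right₀ (by norm_num) (by omega)
    rw [blockKernel, aliasKernel_eq_zero (by push_cast; exact h),
      aliasKernel_eq_zero (by push_cast; exact this.trans_lt h), sub_zero]

/-- Both interpolants in the difference reproduce `e^{int}`. -/
theorem blockKernel_succ_eq_zero {j : ℕ} {m n : ℤ} (h : |n| ≤ (2 : ℤ) ^ j) :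
    blockKernel (j + 1) m n = 0 := by
  have : (2 : ℤ) ^ j ≤ 2 ^ (j + 1) := pow_le_pow_right₀ (by norm_num) (by omega)
  rw [blockKernel, aliasKernel_of_abs_le (by push_cast; exact h.trans this),
    aliasKernel_of_abs_le (by push_cast; exact h), sub_self]

theorem norm_blockKernel_le (j : ℕ) (m n : ℤ) : ‖blockKernel j m n‖ ≤ 1 := by
  cases j with
  | zero =>
    rw [blockKernel, aliasKernel]
    split_ifs <;> simp
  | succ j =>
    rw [blockKernel, aliasKernel, aliasKernel]
    split_ifs <;> simp

theorem norm_tensorKernel_le {d : ℕ} (k : Fin d → ℕ) (m n : Fin d → ℤ) :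
    ‖tensorKernel k m n‖ ≤ 1 := by
  rw [tensorKernel, norm_prod]
  exact Finset.prod_le_one (fun _ _ => norm_nonneg _) fun j _ => norm_blockKernel_le _ _ _

theorem tensorKernel_eq_zero {d : ℕ} {k : Fin d → ℕ} {m : Fin d → ℤ} (n : Fin d → ℤ)
    (h : m ∉ freqBox k) : tensorKernel k m n = 0 := by
  simp only [freqBox, Fintype.mem_piFinset, Finset.mem_Icc, not_forall] at h
  obtain ⟨j, hj⟩ := h
  exact Finset.prod_eq_zero (Finset.mem_univ j)
    (blockKernel_eq_zero_of_lt (not_le.1 fun h => hj (abs_le.1 h)))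

theorem summable_mul_tensorKernel {d : ℕ} {a : (Fin d → ℤ) → ℂ} (ha : Summable fun n => ‖a n‖)
    (k : Fin d → ℕ) (m : Fin d → ℤ) : Summable fun n => a n * tensorKernel k m n :=
  Summable.of_norm_bounded ha fun n => by
    rw [norm_mul]
    exact mul_le_of_le_one_right (norm_nonneg _) (norm_tensorKernel_le k m n)

theorem q_tsum_expo {d : ℕ} {a : (Fin d → ℤ) → ℂ} (ha : Summable fun n => ‖a n‖)
    (k : Fin d → ℕ) :
    q k (fun x => ∑' n, a n * expo n x)
      = ∑ m ∈ freqBox k, fun x => (∑' n, a n * tensorKernel k m n) * expo m x := by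
  funext x
  have h := (hasSum_q k (fun x => (summable_mul_expo ha x).hasSum) x).tsum_eq
  rw [← h, Finset.sum_apply]
  simp only [q_const_mul_expo]
  rw [Summable.tsum_finsetSum fun m _ => (summable_mul_tensorKernel ha k m).mul_right _]
  simp only [tsum_mul_right]

theorem continuous_q_tsum_expo {d : ℕ} {a : (Fin d → ℤ) → ℂ} (ha : Summable fun n => ‖a n‖)
    (k : Fin d → ℕ) : Continuous (q k fun x => ∑' n, a n * expo n x) := by
  rw [q_tsum_expo ha]
  exact Finset.sum_induction _ Continuous (fun _ _ => Continuous.add) continuous_const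
    fun m _ => continuous_const.mul (continuous_expo m)

theorem coeff_q_tsum_expo {d : ℕ} {a : (Fin d → ℤ) → ℂ} (ha : Summable fun n => ‖a n‖)
    (k : Fin d → ℕ) (m : Fin d → ℤ) :
    coeff (q k fun x => ∑' n, a n * expo n x) m = ∑' n, a n * tensorKernel k m n := by
  have hint : ∀ l : Fin d → ℤ, Integrable fun x => (∑' n, a n * tensorKernel k l n) * expo l x :=
    fun l => integrable_of_continuous (continuous_const.mul (continuous_expo l))
  rw [q_tsum_expo ha, coeff_sum _ fun l _ => hint l]
  simp only [coeff_const_mul, coeff_expo, mul_ite, mul_one, mul_zero, Finset.sum_ite_eq']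
  split_ifs with h
  · rfl
  · simp [tensorKernel_eq_zero _ h]

theorem sum_range_blockKernel (J : ℕ) (m n : ℤ) :
    ∑ j ∈ Finset.range (J + 1), blockKernel j m n = aliasKernel (2 ^ J) m n := by
  induction J with
  | zero => simp [blockKernel]
  | succ J ih => rw [Finset.sum_range_succ, ih, blockKernel]; ring

theorem exists_sum_tensorKernel_eq {d : ℕ} (n : Fin d → ℤ) : ∃ s : Finset (Fin d → ℕ),
    (∀ k ∉ s, ∀ m, tensorKernel k m n = 0) ∧
      ∀ m, ∑ k ∈ s, tensorKernel k m n = if m = n then 1 else 0 := by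
  obtain ⟨J, hJ⟩ : ∃ J : ℕ, ∀ j, |n j| ≤ (2 : ℤ) ^ J := by
    refine ⟨∑ j, (n j).natAbs, fun j => ?_⟩
    have h1 : (n j).natAbs ≤ ∑ j, (n j).natAbs :=
      Finset.single_le_sum (f := fun j => (n j).natAbs) (fun _ _ => Nat.zero_le _)
        (Finset.mem_univ j)
    rw [Int.abs_eq_natAbs]
    exact_mod_cast h1.trans Nat.lt_two_pow_self.le
  refine ⟨Fintype.piFinset fun _ => Finset.range (J + 1), fun k hk m => ?_, fun m => ?_⟩
  · simp only [Fintype.mem_piFinset, Finset.mem_range, not_forall, not_lt] at hk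
    obtain ⟨j, hj⟩ := hk
    refine Finset.prod_eq_zero (Finset.mem_univ j) ?_
    obtain ⟨i, hi⟩ : ∃ i, k j = i + 1 := ⟨k j - 1, by omega⟩
    rw [hi]
    exact blockKernel_succ_eq_zero ((hJ j).trans (pow_le_pow_right₀ (by norm_num) (by omega)))
  · simp only [tensorKernel]
    -- Over a cube of indices the sum factorises, and each factor telescopes to a single
    -- interpolation that reproduces `n j`.
    rw [Finset.sum_prod_piFinset (Finset.range (J + 1))
      fun i j => blockKernel j (m i) (n i)]
    simp only [sum_range_blockKernel]
    have h2 : ∀ j, aliasKernel (2 ^ J) (m j) (n j) = if m j = n j then 1 else 0 := fun j =>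
      aliasKernel_of_abs_le (by push_cast; exact hJ j)
    simp only [h2]
    split_ifs with h
    · simp [h]
    · obtain ⟨j, hj⟩ := Function.ne_iff.1 h
      exact Finset.prod_eq_zero (Finset.mem_univ j) (if_neg hj)

/-- The part of the kernel that is not captured by the Smolyak operator. -/
theorem enorm_sub_sum_tensorKernel_le {d : ℕ} {α γ ξ : ℝ} (s : Finset (Fin d → ℕ))
    (hs : ∀ k ∉ s, ξ ≤ (α - γ) * ((∑ j, k j : ℕ) : ℝ)) (m n : Fin d → ℤ) :
    ‖(if m = n then 1 else 0) - ∑ k ∈ s, tensorKernel k m n‖ₑ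
      ≤ ENNReal.ofReal (2 ^ (-ξ)) * ∑' k : Fin d → ℕ,
        ∏ j, (ENNReal.ofReal (2 ^ ((α - γ) * k j)) * ‖blockKernel (k j) (m j) (n j)‖ₑ) := by
  classical
  obtain ⟨u, hu0, hu⟩ := exists_sum_tensorKernel_eq n
  have h1 : (if m = n then (1 : ℂ) else 0) - ∑ k ∈ s, tensorKernel k m n
      = ∑ k ∈ u \ s, tensorKernel k m n := by
    rw [← hu m, sub_eq_iff_eq_add, ← Finset.sum_inter_add_sum_sdiff u s, add_comm, Finset.inter_comm]
    congr 1
    refine Finset.sum_subset Finset.inter_subset_left fun k hk hk' => hu0 k ?_ m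
    exact fun h => hk' (Finset.mem_inter.2 ⟨hk, h⟩)
  rw [h1, ← ENNReal.tsum_mul_left]
  refine (enorm_sum_le _ _).trans ?_
  refine le_trans (Finset.sum_le_sum fun k hk => ?_) (ENNReal.sum_le_tsum (u \ s))
  have hk := hs k (Finset.mem_sdiff.1 hk).2
  rw [Finset.prod_mul_distrib, ← ENNReal.ofReal_prod_of_nonneg (fun _ _ => by positivity),
    ← mul_assoc, ← ENNReal.ofReal_mul (by positivity), ← Real.rpow_sum_of_pos two_pos,
    ← Real.rpow_add two_pos, ← Finset.mul_sum]
  -- The factor `2^{-ξ}` is gained here: outside `s` this weight is at least 1, and being a product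
  -- over coordinates it keeps the kernel a tensor product.
  have h2 : (1 : ENNReal) ≤ ENNReal.ofReal (2 ^ (-ξ + (α - γ) * ∑ j, (k j : ℝ))) := by
    rw [ENNReal.one_le_ofReal]
    refine Real.one_le_rpow one_le_two ?_
    push_cast at hk
    linarith
  have h3 : ‖tensorKernel k m n‖ₑ = ∏ j, ‖blockKernel (k j) (m j) (n j)‖ₑ := by
    simp only [tensorKernel, ← ofReal_norm, norm_prod]
    rw [ENNReal.ofReal_prod_of_nonneg fun _ _ => norm_nonneg _]
  rw [h3]
  exact le_mul_of_one_le_left zero_le h2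

theorem continuous_samplingOp_tsum_expo {d : ℕ} {a : (Fin d → ℤ) → ℂ}
    (ha : Summable fun n => ‖a n‖) {Δ : Set (Fin d → ℕ)} (hΔ : Δ.Finite) :
    Continuous (samplingOp Δ fun x => ∑' n, a n * expo n x) := by
  rw [samplingOp, finsum_mem_eq_finite_toFinset_sum _ hΔ]
  exact Finset.sum_induction _ Continuous (fun _ _ => Continuous.add) continuous_const
    fun k _ => continuous_q_tsum_expo ha k

theorem coeff_samplingOp_tsum_expo {d : ℕ} {a : (Fin d → ℤ) → ℂ}
    (ha : Summable fun n => ‖a n‖) {Δ : Set (Fin d → ℕ)} (hΔ : Δ.Finite) (m : Fin d → ℤ) :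
    coeff (samplingOp Δ fun x => ∑' n, a n * expo n x) m
      = ∑' n, a n * ∑ k ∈ hΔ.toFinset, tensorKernel k m n := by
  rw [samplingOp, finsum_mem_eq_finite_toFinset_sum _ hΔ, coeff_sum _ fun k _ =>
    integrable_of_continuous (continuous_q_tsum_expo ha k)]
  simp only [coeff_q_tsum_expo ha, Finset.mul_sum]
  rw [Summable.tsum_finsetSum fun k _ => summable_mul_tensorKernel ha k m]

/-- Bound of the Fourier coefficients of the error of the Smolyak operator. -/
theorem enorm_coeff_sub_samplingOp_le {d : ℕ} {α γ : ℝ} (h : γ < α) (ξ : ℝ) {f : Torus d → ℂ}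
    (hf : Integrable f) (hs : Summable fun n => ‖coeff f n‖) (m : Fin d → ℤ) :
    ‖coeff (f - samplingOp (smolyakSet d α γ ξ) fun x => ∑' n, coeff f n * expo n x) m‖ₑ
      ≤ ENNReal.ofReal (2 ^ (-ξ)) * ∑' n, ∑' k : Fin d → ℕ, ‖coeff f n‖ₑ *
        ∏ j, (ENNReal.ofReal (2 ^ ((α - γ) * k j)) * ‖blockKernel (k j) (m j) (n j)‖ₑ) := by
  have hΔ := smolyakSet_finite d h ξ
  have hsum : Summable fun n => coeff f n * ∑ k ∈ hΔ.toFinset, tensorKernel k m n := by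
    simp only [Finset.mul_sum]
    exact summable_sum fun k _ => summable_mul_tensorKernel hs k m
  have h1 : coeff f m = ∑' n, coeff f n * (if m = n then 1 else 0) := by
    rw [tsum_eq_single m fun n hn => by simp [hn.symm]]
    simp
  have h1s : Summable fun n => coeff f n * (if m = n then (1 : ℂ) else 0) :=
    summable_of_ne_finset_zero (s := {m}) fun n hn => by
      rw [if_neg (fun h => hn (by simp [h])), mul_zero]
  rw [coeff_sub hf (integrable_of_continuous (continuous_samplingOp_tsum_expo hs hΔ)),
    coeff_samplingOp_tsum_expo hs hΔ, h1, ← h1s.tsum_sub hsum, ← ENNReal.tsum_mul_left]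
  simp only [← mul_sub]
  refine (enorm_tsum_le_tsum_enorm).trans (ENNReal.tsum_le_tsum fun n => ?_)
  rw [enorm_mul, ENNReal.tsum_mul_left, mul_left_comm]
  gcongr
  refine enorm_sub_sum_tensorKernel_le _ (fun k hk => ?_) m n
  rw [Set.Finite.mem_toFinset] at hk
  exact (not_le.1 hk).le

/-! ### A Schur test for tensor product kernels -/

theorem tsum_pi_prod {d : ℕ} {X : Type*} (F : Fin d → X → ENNReal) :
    ∑' k : Fin d → X, ∏ j, F j (k j) = ∏ j, ∑' x, F j x := by
  induction d with
  | zero => simp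
  | succ d ih =>
    rw [← (Fin.consEquiv fun _ : Fin (d + 1) => X).tsum_eq, ENNReal.tsum_prod', Fin.prod_univ_succ,
      ← ih, ← ENNReal.tsum_mul_right]
    refine tsum_congr fun x => ?_
    rw [← ENNReal.tsum_mul_left]
    refine tsum_congr fun k => ?_
    rw [Fin.prod_univ_succ]
    simp

/-- The Cauchy-Schwarz inequality. -/
theorem sq_tsum_le {ι : Type*} {T U V : ι → ENNReal} (h : ∀ i, T i ^ 2 ≤ U i * V i) :
    (∑' i, T i) ^ 2 ≤ (∑' i, U i) * ∑' i, V i := by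
  have hT : ∀ i, T i ≤ U i ^ (1 / 2 : ℝ) * V i ^ (1 / 2 : ℝ) := fun i => by
    have h1 := ENNReal.rpow_le_rpow (h i) (show (0 : ℝ) ≤ 1 / 2 by norm_num)
    rw [ENNReal.mul_rpow_of_nonneg _ _ (by norm_num), ← ENNReal.rpow_natCast,
      ← ENNReal.rpow_mul] at h1
    simpa using h1
  have h2 : ∑' i, T i ≤ (∑' i, U i) ^ (1 / 2 : ℝ) * (∑' i, V i) ^ (1 / 2 : ℝ) := by
    rw [ENNReal.tsum_eq_iSup_sum]
    refine iSup_le fun s => ?_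
    refine (Finset.sum_le_sum fun i _ => hT i).trans ?_
    refine (ENNReal.inner_le_Lp_mul_Lq s _ _ Real.HolderConjugate.two_two).trans ?_
    simp only [← ENNReal.rpow_mul]
    norm_num
    gcongr <;> exact ENNReal.sum_le_tsum s
  refine (pow_le_pow_left₀ zero_le h2 2).trans_eq ?_
  rw [mul_pow, ← ENNReal.rpow_natCast, ← ENNReal.rpow_natCast, ← ENNReal.rpow_mul,
    ← ENNReal.rpow_mul]
  norm_num

/-- Moving `W ^ (1 / 2)` inside the sum avoids dividing by `W`, which may be zero or infinite. -/
theorem sq_tsum_mul_le {ι : Type*} {T U V : ι → ENNReal} (W : ENNReal)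
    (h : ∀ i, T i ^ 2 * W ≤ U i * V i) : (∑' i, T i) ^ 2 * W ≤ (∑' i, U i) * ∑' i, V i := by
  have hW : (W ^ (1 / 2 : ℝ)) ^ 2 = W := by
    rw [← ENNReal.rpow_natCast, ← ENNReal.rpow_mul]
    norm_num
  have h1 := sq_tsum_le (T := fun i => T i * W ^ (1 / 2 : ℝ)) (U := U) (V := V) fun i => by
    rw [mul_pow, hW]
    exact h i
  rwa [ENNReal.tsum_mul_right, mul_pow, hW] at h1

/-- A Schur test for tensor product kernels, with an additional summation variable on which the
weights may depend. -/
theorem tensor_schur_test {d : ℕ} {I J K : Type*} {t u v : K → I → J → ENNReal} {w : I → ENNReal}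
    {z : J → ENNReal} {A B : ENNReal} (h : ∀ k m n, t k m n ^ 2 * w m ≤ u k m n * (v k m n * z n))
    (hu : ∀ m, ∑' k, ∑' n, u k m n ≤ A) (hv : ∀ n, ∑' k, ∑' m, v k m n ≤ B)
    (b : (Fin d → J) → ENNReal) :
    ∑' m : Fin d → I, (∑' n : Fin d → J, ∑' k : Fin d → K, b n * ∏ j, t (k j) (m j) (n j)) ^ 2 *
        ∏ j, w (m j)
      ≤ A ^ d * B ^ d * ∑' n : Fin d → J, b n ^ 2 * ∏ j, z (n j) := by
  have h1 : ∀ m : Fin d → I,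
      (∑' n : Fin d → J, ∑' k : Fin d → K, b n * ∏ j, t (k j) (m j) (n j)) ^ 2 * ∏ j, w (m j)
      ≤ A ^ d * ∑' n : Fin d → J, ∑' k : Fin d → K,
        (∏ j, v (k j) (m j) (n j)) * (b n ^ 2 * ∏ j, z (n j)) := fun m => by
    have hA : ∑' n : Fin d → J, ∑' k : Fin d → K, ∏ j, u (k j) (m j) (n j) ≤ A ^ d := by
      rw [ENNReal.tsum_comm]
      have : ∀ k : Fin d → K, ∑' n : Fin d → J, ∏ j, u (k j) (m j) (n j)
          = ∏ j, ∑' n, u (k j) (m j) n := fun k => tsum_pi_prod fun j n => u (k j) (m j) n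
      simp only [this]
      rw [tsum_pi_prod fun j k => ∑' n, u k (m j) n]
      refine (Finset.prod_le_prod' fun j _ => hu (m j)).trans_eq ?_
      simp
    rw [← ENNReal.tsum_prod] at hA
    rw [← ENNReal.tsum_prod, ← ENNReal.tsum_prod]
    -- Cauchy–Schwarz over the pairs `(n, k)` jointly; all weights are products, so the `u`-sum is
    -- the `d`-fold product bounded by `A ^ d`.
    refine le_trans (sq_tsum_mul_le _ fun p => ?_) (mul_le_mul_left hA _)
    calc (b p.1 * ∏ j, t (p.2 j) (m j) (p.1 j)) ^ 2 * ∏ j, w (m j)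
        = b p.1 ^ 2 * ∏ j, (t (p.2 j) (m j) (p.1 j) ^ 2 * w (m j)) := by
          rw [mul_pow, Finset.prod_mul_distrib, Finset.prod_pow, mul_assoc]
      _ ≤ b p.1 ^ 2 * ∏ j, (u (p.2 j) (m j) (p.1 j) * (v (p.2 j) (m j) (p.1 j) * z (p.1 j))) := by
          exact mul_le_mul_right (Finset.prod_le_prod' fun j _ => h _ _ _) _
      _ = (∏ j, u (p.2 j) (m j) (p.1 j)) *
            ((∏ j, v (p.2 j) (m j) (p.1 j)) * (b p.1 ^ 2 * ∏ j, z (p.1 j))) := by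
          rw [Finset.prod_mul_distrib, Finset.prod_mul_distrib]
          ring
  refine (ENNReal.tsum_le_tsum h1).trans ?_
  rw [ENNReal.tsum_mul_left, mul_assoc]
  gcongr
  rw [ENNReal.tsum_comm, ← ENNReal.tsum_mul_left]
  refine ENNReal.tsum_le_tsum fun n => ?_
  simp only [ENNReal.tsum_mul_right]
  gcongr
  rw [ENNReal.tsum_comm]
  have : ∀ k : Fin d → K, ∑' m : Fin d → I, ∏ j, v (k j) (m j) (n j)
      = ∏ j, ∑' m, v (k j) m (n j) := fun k => tsum_pi_prod fun j m => v (k j) m (n j)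
  simp only [this]
  rw [tsum_pi_prod fun j k => ∑' m, v k m (n j)]
  refine (Finset.prod_le_prod' fun j _ => hv (n j)).trans_eq ?_
  simp

/-! ### Univariate estimates -/

/-- Injectivity on the support is what allows reindexing by truncated subtraction or integer
division. -/
theorem tsum_le_tsum_of_injOn {ι κ : Type*} {F : ι → ENNReal} {G : κ → ENNReal} (e : ι → κ)
    (he : Set.InjOn e (Function.support F)) (h : ∀ i, F i ≠ 0 → F i ≤ G (e i)) :
    ∑' i, F i ≤ ∑' k, G k := by
  rw [← tsum_subtype_support F]
  refine (ENNReal.tsum_le_tsum fun i : Function.support F => h i i.2).trans ?_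
  exact ENNReal.tsum_comp_le_tsum_of_injective (Set.injOn_iff_injective.1 he) G

theorem tsum_geometric_ne_top {θ : ℝ} (hθ : 0 < θ) :
    ∑' i : ℕ, ENNReal.ofReal ((4 : ℝ) ^ (-θ)) ^ i ≠ ⊤ := by
  rw [ENNReal.tsum_geometric, ENNReal.inv_ne_top]
  refine (tsub_pos_of_lt ?_).ne'
  rw [← ENNReal.ofReal_one, ENNReal.ofReal_lt_ofReal_iff one_pos]
  exact Real.rpow_lt_one_of_one_lt_of_neg (by norm_num) (by linarith)

theorem ofReal_rpow_le_of_le {θ x : ℝ} (hθ : 0 < θ) (hx : 0 ≤ x) {i : ℕ}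
    (h : x * 4 ^ i ≤ 1) : ENNReal.ofReal (x ^ θ) ≤ ENNReal.ofReal ((4 : ℝ) ^ (-θ)) ^ i := by
  rw [← ENNReal.ofReal_pow (by positivity)]
  refine ENNReal.ofReal_le_ofReal ?_
  rw [← Real.rpow_natCast, ← Real.rpow_mul (by norm_num), mul_comm, Real.rpow_mul (by norm_num),
    Real.rpow_neg (by positivity), ← Real.inv_rpow (by positivity), Real.rpow_natCast]
  refine Real.rpow_le_rpow hx ?_ hθ.le
  rw [← one_div, le_div_iff₀ (by positivity)]
  exact h

/-- Counting from the least `k₀` with `x ≤ 4 ^ k₀`, the terms decay geometrically, uniformly in `x`.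
-/
theorem tsum_rpow_div_four_pow_le {θ x : ℝ} (hθ : 0 < θ) (hx : 0 < x) :
    ∑' k : ℕ, (if x ≤ 4 ^ k then ENNReal.ofReal ((x / 4 ^ k) ^ θ) else 0)
      ≤ ∑' i : ℕ, ENNReal.ofReal ((4 : ℝ) ^ (-θ)) ^ i := by
  obtain ⟨k₀, hk₀⟩ : ∃ k₀ : ℕ, x ≤ 4 ^ k₀ ∧ ∀ k, x ≤ 4 ^ k → k₀ ≤ k := by
    have hex : ∃ k : ℕ, x ≤ 4 ^ k := (pow_unbounded_of_one_lt x (by norm_num)).imp fun _ h => h.le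
    classical
    exact ⟨Nat.find hex, Nat.find_spec hex, fun k hk => Nat.find_min' hex hk⟩
  refine tsum_le_tsum_of_injOn (fun k => k - k₀) ?_ fun k hk => ?_
  · intro a ha b hb hab
    have h1 := hk₀.2 a (by by_contra h; simp [h] at ha)
    have h2 := hk₀.2 b (by by_contra h; simp [h] at hb)
    simp only at hab
    omega
  · have hxk : x ≤ 4 ^ k := by by_contra h; simp [h] at hk
    rw [if_pos hxk]
    refine ofReal_rpow_le_of_le hθ (by positivity) ?_
    have h3 : (4 : ℝ) ^ k = 4 ^ k₀ * 4 ^ (k - k₀) := by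
      rw [← pow_add]; congr 1; have := hk₀.2 k hxk; omega
    rw [div_mul_eq_mul_div, div_le_one (by positivity), h3]
    exact mul_le_mul_of_nonneg_right hk₀.1 (by positivity)

theorem tsum_rpow_four_pow_div_le {θ x : ℝ} (hθ : 0 < θ) (hx : 0 < x) :
    ∑' k : ℕ, (if (4 : ℝ) ^ k ≤ x then ENNReal.ofReal ((4 ^ k / x) ^ θ) else 0)
      ≤ ∑' i : ℕ, ENNReal.ofReal ((4 : ℝ) ^ (-θ)) ^ i := by
  obtain ⟨k₁, hk₁⟩ : ∃ k₁ : ℕ, x < 4 ^ k₁ := pow_unbounded_of_one_lt x (by norm_num)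
  have hlt : ∀ k : ℕ, (4 : ℝ) ^ k ≤ x → k < k₁ := fun k hk =>
    (pow_lt_pow_iff_right₀ (by norm_num)).1 (hk.trans_lt hk₁)
  classical
  -- Here the decay runs downwards from the greatest admissible index; `k₁` only bounds the search.
  set k₀ := Nat.findGreatest (fun k => (4 : ℝ) ^ k ≤ x) k₁ with hk₀
  have hle : ∀ k : ℕ, (4 : ℝ) ^ k ≤ x → k ≤ k₀ := fun k hk =>
    Nat.le_findGreatest (hlt k hk).le hk
  refine tsum_le_tsum_of_injOn (fun k => k₀ - k) ?_ fun k hk => ?_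
  · intro a ha b hb hab
    have h1 := hle a (by by_contra h; simp [h] at ha)
    have h2 := hle b (by by_contra h; simp [h] at hb)
    simp only at hab
    omega
  · have hxk : (4 : ℝ) ^ k ≤ x := by by_contra h; simp [h] at hk
    rw [if_pos hxk]
    refine ofReal_rpow_le_of_le hθ (by positivity) ?_
    have h4 : (4 : ℝ) ^ k₀ ≤ x := Nat.findGreatest_spec (P := fun k => (4 : ℝ) ^ k ≤ x)
      (hlt k hxk).le hxk
    rw [div_mul_eq_mul_div, div_le_one (by positivity), ← pow_add]
    have := hle k hxk
    rwa [show k + (k₀ - k) = k₀ by omega]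

/-- The sum `∑_l (1 + l²)^{-β/2}`. -/
def bracketSum (β : ℝ) : ENNReal := ∑' l : ℤ, ENNReal.ofReal ((1 + (l : ℝ) ^ 2) ^ (-β / 2))

theorem bracketSum_ne_top {β : ℝ} (hβ : 1 < β) : bracketSum β ≠ ⊤ := by
  -- The real power gives `0 ^ (-β) = 0`, so the term at `l = 0` needs its own majorant.
  have h1 : Summable fun l : ℤ => |(l : ℝ)| ^ (-β) + if l = 0 then 1 else 0 :=
    (Real.summable_abs_int_rpow hβ).add
      (summable_of_ne_finset_zero (s := {0}) fun l hl => if_neg (by simpa using hl))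
  have h2 : Summable fun l : ℤ => (1 + (l : ℝ) ^ 2) ^ (-β / 2) := by
    refine Summable.of_nonneg_of_le (fun l => by positivity) (fun l => ?_) h1
    split_ifs with h
    · subst h
      simp only [Int.cast_zero]
      norm_num
      positivity
    · have hl : (0 : ℝ) < |(l : ℝ)| := by simpa using h
      rw [add_zero, show -β = 2 * (-β / 2) by ring, Real.rpow_mul hl.le]
      norm_num
      refine Real.rpow_le_rpow_of_nonpos (by simpa [sq_pos_iff] using h) (by linarith) (by linarith)
  exact h2.tsum_ofReal_ne_top

theorem enorm_aliasKernel_le (M : ℕ) (m n : ℤ) : ‖aliasKernel M m n‖ₑ ≤ 1 := by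
  unfold aliasKernel
  split_ifs <;> simp

theorem of_aliasKernel_ne_zero {M : ℕ} {m n : ℤ} (h : aliasKernel M m n ≠ 0) :
    |m| ≤ (M : ℤ) ∧ (2 * M + 1 : ℤ) ∣ n - m := by
  by_contra h'
  exact h (if_neg h')

/-- Each `n` is aliased to at most one `m`, since `[-M, M]` has no two elements congruent modulo
`2M+1`. -/
theorem tsum_enorm_aliasKernel_le (M : ℕ) (n : ℤ) : ∑' m, ‖aliasKernel M m n‖ₑ ≤ 1 := by
  have h := tsum_le_tsum_of_injOn (F := fun m => ‖aliasKernel M m n‖ₑ) (G := fun _ : Unit => 1)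
    (fun _ => ()) ?_ fun m _ => enorm_aliasKernel_le M m n
  · simpa using h
  · intro a ha b hb _
    obtain ⟨ha1, ha2⟩ := of_aliasKernel_ne_zero (enorm_ne_zero.1 ha)
    obtain ⟨hb1, hb2⟩ := of_aliasKernel_ne_zero (enorm_ne_zero.1 hb)
    have h3 : a - b = 0 := by
      refine Int.eq_zero_of_abs_lt_dvd (by simpa using dvd_sub hb2 ha2) ?_
      rw [abs_le] at ha1 hb1
      rw [abs_lt]
      constructor <;> omega
    omega

/-- Away from a neighbourhood of the origin, the weights that are aliased to a given frequency
have a sum that is as small as expected. -/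
theorem tsum_weight_aliasKernel_le {β X : ℝ} (hβ : 0 < β) (hX : 0 < X) {M : ℕ}
    (hXM : X ≤ (M : ℝ) ^ 2) {p : ℤ → Prop} [DecidablePred p] (hp : ∀ n, p n → X ≤ 1 + (n : ℝ) ^ 2)
    (m : ℤ) :
    ∑' n : ℤ, (if p n then ENNReal.ofReal ((1 + (n : ℝ) ^ 2) ^ (-β / 2)) * ‖aliasKernel M m n‖ₑ
        else 0)
      ≤ ENNReal.ofReal ((X / 2) ^ (-β / 2)) * bracketSum β := by
  rw [bracketSum, ← ENNReal.tsum_mul_left]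
  have hN : (2 * M + 1 : ℤ) ≠ 0 := by omega
  have key : ∀ n, (if p n then ENNReal.ofReal ((1 + (n : ℝ) ^ 2) ^ (-β / 2)) *
      ‖aliasKernel M m n‖ₑ else 0) ≠ 0 → p n ∧ |m| ≤ (M : ℤ) ∧ (2 * M + 1 : ℤ) ∣ n - m := by
    intro n hn
    have h1 : p n := by by_contra h; simp [h] at hn
    rw [if_pos h1] at hn
    exact ⟨h1, of_aliasKernel_ne_zero (enorm_ne_zero.1 (right_ne_zero_of_mul hn))⟩
  refine tsum_le_tsum_of_injOn (fun n => (n - m) / (2 * M + 1)) ?_ fun n hn => ?_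
  · intro a ha b hb hab
    have h1 := Int.ediv_mul_cancel (key a ha).2.2
    have h2 := Int.ediv_mul_cancel (key b hb).2.2
    simp only at hab
    rw [hab, h2] at h1
    omega
  · obtain ⟨h1, h2, l, hl⟩ := key n hn
    have hl' : (n - m) / (2 * M + 1 : ℤ) = l := by rw [hl, Int.mul_ediv_cancel_left _ hN]
    simp only [hl']
    rw [if_pos h1]
    refine (mul_le_of_le_one_right zero_le (enorm_aliasKernel_le M m n)).trans ?_
    rw [← ENNReal.ofReal_mul (by positivity), ← Real.mul_rpow (by positivity) (by positivity)]
    refine ENNReal.ofReal_le_ofReal (Real.rpow_le_rpow_of_nonpos (by positivity) ?_ (by linarith))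
    -- With `n = m + (2M+1)l`, the case `l = 0` rests on `hp`. Otherwise `|n| ≥ (2M+1)|l| - M ≥
    -- M|l|`, so `1 + n² ≥ X l² ≥ (X/2)(1 + l²)`.
    rcases eq_or_ne l 0 with rfl | hl0
    · have := hp n h1
      simp
      linarith
    · have h3 : (1 : ℤ) ≤ |l| := Int.one_le_abs hl0
      have h4 : (M : ℤ) * |l| ≤ |n| := by
        have h5 : |(2 * M + 1 : ℤ) * l| ≤ |n| + |m| := by rw [← hl]; exact abs_sub _ _
        rw [abs_mul, abs_of_nonneg (by omega : (0 : ℤ) ≤ 2 * M + 1)] at h5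
        nlinarith
      have h6 : (M : ℝ) * |(l : ℝ)| ≤ |(n : ℝ)| := by exact_mod_cast h4
      have h7 : (M : ℝ) ^ 2 * (l : ℝ) ^ 2 ≤ (n : ℝ) ^ 2 := by
        rw [← sq_abs (l : ℝ), ← sq_abs (n : ℝ), ← mul_pow]
        exact pow_le_pow_left₀ (by positivity) h6 2
      have h8 : (1 : ℝ) ≤ (l : ℝ) ^ 2 := by
        rw [← sq_abs]
        exact one_le_pow₀ (by exact_mod_cast h3)
      have h9 : X * (l : ℝ) ^ 2 ≤ (M : ℝ) ^ 2 * (l : ℝ) ^ 2 := by gcongr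
      nlinarith

/-- The degree bounds `m` from above, and reproduction bounds `n` from below; the summand 1 covers
`k = 0`. -/
theorem of_blockKernel_ne_zero {k : ℕ} {m n : ℤ} (h : blockKernel k m n ≠ 0) :
    (m : ℝ) ^ 2 ≤ 4 ^ k ∧ (4 : ℝ) ^ k ≤ 4 * (1 + (n : ℝ) ^ 2) := by
  have h1 : |m| ≤ (2 : ℤ) ^ k := not_lt.1 fun h' => h (blockKernel_eq_zero_of_lt h')
  constructor
  · have h2 : |(m : ℝ)| ≤ 2 ^ k := by exact_mod_cast h1
    have h3 := pow_le_pow_left₀ (abs_nonneg _) h2 2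
    rwa [sq_abs, ← pow_mul, mul_comm, pow_mul, show (2 : ℝ) ^ 2 = 4 by norm_num] at h3
  · cases k with
    | zero => nlinarith [sq_nonneg (n : ℝ)]
    | succ j =>
      have h2 : (2 : ℤ) ^ j ≤ |n| := by
        by_contra h'
        exact h (blockKernel_succ_eq_zero (not_le.1 h').le)
      have h2' : (2 : ℝ) ^ j ≤ |(n : ℝ)| := by exact_mod_cast h2
      have h3 := pow_le_pow_left₀ (by positivity) h2' 2
      rw [sq_abs, ← pow_mul, mul_comm, pow_mul, show (2 : ℝ) ^ 2 = 4 by norm_num] at h3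
      rw [pow_succ]
      linarith

/-- The kernel of `η_k` is dominated by two alias kernels. -/
theorem exists_enorm_blockKernel_le (k : ℕ) : ∃ M M' : ℕ, (4 : ℝ) ^ k / 4 ≤ (M : ℝ) ^ 2 ∧
    (4 : ℝ) ^ k / 4 ≤ (M' : ℝ) ^ 2 ∧
    ∀ m n, ‖blockKernel k m n‖ₑ ≤ ‖aliasKernel M m n‖ₑ + ‖aliasKernel M' m n‖ₑ := by
  have h4 : ∀ j : ℕ, (((2 ^ j : ℕ) : ℝ)) ^ 2 = 4 ^ j := fun j => by
    push_cast
    rw [← pow_mul, mul_comm, pow_mul]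
    norm_num
  cases k with
  | zero =>
    refine ⟨1, 1, by norm_num, by norm_num, fun m n => ?_⟩
    exact le_self_add
  | succ j =>
    refine ⟨2 ^ (j + 1), 2 ^ j, ?_, ?_, fun m n => enorm_sub_le⟩
    · rw [h4]
      linarith [pow_pos (show (0 : ℝ) < 4 by norm_num) (j + 1)]
    · rw [h4, pow_succ]
      linarith

theorem tsum_enorm_blockKernel_le (k : ℕ) (n : ℤ) : ∑' m, ‖blockKernel k m n‖ₑ ≤ 2 := by
  obtain ⟨M, M', -, -, h⟩ := exists_enorm_blockKernel_le k
  refine (ENNReal.tsum_le_tsum fun m => h m n).trans ?_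
  rw [ENNReal.tsum_add, ← one_add_one_eq_two]
  exact add_le_add (tsum_enorm_aliasKernel_le M n) (tsum_enorm_aliasKernel_le M' n)

theorem tsum_weight_blockKernel_le {β : ℝ} (hβ : 0 < β) (k : ℕ) (m : ℤ) :
    ∑' n : ℤ, ENNReal.ofReal ((1 + (n : ℝ) ^ 2) ^ (-β / 2)) * ‖blockKernel k m n‖ₑ
      ≤ 2 * (ENNReal.ofReal (((4 : ℝ) ^ k / 4 / 2) ^ (-β / 2)) * bracketSum β) := by
  classical
  obtain ⟨M, M', hM, hM', h⟩ := exists_enorm_blockKernel_le k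
  -- The cancellation at low `n` has to be used before the triangle inequality: where `p` fails
  -- `blockKernel` vanishes, but the separate alias kernels need not.
  let p : ℤ → Prop := fun n => (4 : ℝ) ^ k / 4 ≤ 1 + (n : ℝ) ^ 2
  have hpos : (0 : ℝ) < 4 ^ k / 4 := by positivity
  have h1 := tsum_weight_aliasKernel_le hβ hpos hM (p := p) (fun n hn => hn) m
  have h2 := tsum_weight_aliasKernel_le hβ hpos hM' (p := p) (fun n hn => hn) m
  rw [two_mul]
  refine le_trans ?_ (add_le_add h1 h2)
  rw [← ENNReal.tsum_add]
  refine ENNReal.tsum_le_tsum fun n => ?_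
  by_cases hp : p n
  · rw [if_pos hp, if_pos hp, ← mul_add]
    gcongr
    exact h m n
  · have h0 : blockKernel k m n = 0 := by
      by_contra h'
      refine hp ?_
      have := (of_blockKernel_ne_zero h').2
      change (4 : ℝ) ^ k / 4 ≤ 1 + (n : ℝ) ^ 2
      linarith
    rw [h0]
    simp

/-- First half of the Schur test: summation over the frequencies that are aliased. -/
theorem exists_tsum_tsum_weight_le {β γ : ℝ} (hβ : 1 < β) (hγ : 0 < γ) :
    ∃ A : ENNReal, A ≠ ⊤ ∧ ∀ m : ℤ, ∑' k : ℕ, ∑' n : ℤ,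
      ENNReal.ofReal ((1 + (m : ℝ) ^ 2) ^ γ * 2 ^ ((β - 2 * γ) * k) *
        (1 + (n : ℝ) ^ 2) ^ (-β / 2)) * ‖blockKernel k m n‖ₑ ≤ A := by
  refine ⟨ENNReal.ofReal (2 ^ γ * 8 ^ (β / 2)) * (2 * bracketSum β) *
    ∑' i : ℕ, ENNReal.ofReal ((4 : ℝ) ^ (-γ)) ^ i, ?_, fun m => ?_⟩
  · exact ENNReal.mul_ne_top (ENNReal.mul_ne_top ENNReal.ofReal_ne_top
      (ENNReal.mul_ne_top (by norm_num) (bracketSum_ne_top hβ))) (tsum_geometric_ne_top hγ)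
  -- The support condition `m² ≤ 4 ^ k` gives `(1 + m²)/2 ≤ 4 ^ k`; the halving costs `2 ^ γ`, and
  -- `8 ^ (β / 2)` comes from the factor `4 ^ k / 8` in the aliasing bound.
  have hx : (0 : ℝ) < (1 + (m : ℝ) ^ 2) / 2 := by positivity
  refine le_trans ?_ (mul_le_mul_right (tsum_rpow_div_four_pow_le hγ hx) _)
  rw [← ENNReal.tsum_mul_left]
  refine ENNReal.tsum_le_tsum fun k => ?_
  split_ifs with h
  · have h1 : ∀ n : ℤ, ENNReal.ofReal ((1 + (m : ℝ) ^ 2) ^ γ * 2 ^ ((β - 2 * γ) * k) *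
        (1 + (n : ℝ) ^ 2) ^ (-β / 2)) * ‖blockKernel k m n‖ₑ
        = ENNReal.ofReal ((1 + (m : ℝ) ^ 2) ^ γ * 2 ^ ((β - 2 * γ) * k)) *
          (ENNReal.ofReal ((1 + (n : ℝ) ^ 2) ^ (-β / 2)) * ‖blockKernel k m n‖ₑ) := fun n => by
      rw [ENNReal.ofReal_mul (by positivity), mul_assoc]
    simp only [h1]
    rw [ENNReal.tsum_mul_left]
    refine (mul_le_mul_right (tsum_weight_blockKernel_le (by linarith) k m) _).trans_eq ?_
    rw [mul_left_comm 2, ← mul_assoc, ← ENNReal.ofReal_mul (by positivity),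
      mul_right_comm (ENNReal.ofReal _), ← ENNReal.ofReal_mul (by positivity)]
    congr 2
    have h4 : (4 : ℝ) ^ k = 2 ^ (2 * (k : ℝ)) := by
      rw [Real.rpow_mul (by norm_num), Real.rpow_natCast]
      norm_num
    rw [show (4 : ℝ) ^ k / 4 / 2 = 4 ^ k / 8 by ring,
      Real.div_rpow (x := 4 ^ k) (y := 8) (by positivity) (by norm_num),
      Real.div_rpow (y := 4 ^ k) (by positivity) (by positivity),
      Real.div_rpow (y := 2) (by positivity) (by norm_num),
      neg_div, Real.rpow_neg (by norm_num : (0 : ℝ) ≤ 8), h4, ← Real.rpow_mul (by norm_num),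
      ← Real.rpow_mul (by norm_num), sub_mul, Real.rpow_sub two_pos,
      show 2 * (k : ℝ) * -(β / 2) = -(β * k) by ring, Real.rpow_neg (by norm_num),
      show 2 * (k : ℝ) * γ = 2 * γ * k by ring]
    have e1 : (2 : ℝ) ^ (β * k) ≠ 0 := by positivity
    have e2 : (2 : ℝ) ^ (2 * γ * k) ≠ 0 := by positivity
    have e3 : (2 : ℝ) ^ γ ≠ 0 := by positivity
    field_simp
  · rw [mul_zero, nonpos_iff_eq_zero, ENNReal.tsum_eq_zero]
    intro n
    have h0 : blockKernel k m n = 0 := by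
      by_contra h'
      refine h ?_
      have h1 := (of_blockKernel_ne_zero h').1
      have h2 : (1 : ℝ) ≤ 4 ^ k := one_le_pow₀ (by norm_num)
      linarith
    rw [h0]
    simp

/-- Second half of the Schur test: summation over the frequencies of the output. -/
theorem exists_tsum_tsum_enorm_blockKernel_le {θ : ℝ} (hθ : 0 < θ) :
    ∃ B : ENNReal, B ≠ ⊤ ∧ ∀ n : ℤ, ∑' k : ℕ, ∑' m : ℤ,
      ENNReal.ofReal (2 ^ (θ * k) * (1 + (n : ℝ) ^ 2) ^ (-θ / 2)) * ‖blockKernel k m n‖ₑ ≤ B := by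
  refine ⟨ENNReal.ofReal (4 ^ (θ / 2)) * 2 *
    ∑' i : ℕ, ENNReal.ofReal ((4 : ℝ) ^ (-(θ / 2))) ^ i, ?_, fun n => ?_⟩
  · exact ENNReal.mul_ne_top (ENNReal.mul_ne_top ENNReal.ofReal_ne_top (by norm_num))
      (tsum_geometric_ne_top (half_pos hθ))
  -- This is the support bound on `4 ^ k`; its factor 4 accounts for `4 ^ (θ / 2)` in the constant.
  have hx : (0 : ℝ) < 4 * (1 + (n : ℝ) ^ 2) := by positivity
  refine le_trans ?_ (mul_le_mul_right (tsum_rpow_four_pow_div_le (half_pos hθ) hx) _)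
  rw [← ENNReal.tsum_mul_left]
  refine ENNReal.tsum_le_tsum fun k => ?_
  rw [ENNReal.tsum_mul_left]
  split_ifs with h
  · refine (mul_le_mul_right (tsum_enorm_blockKernel_le k n) _).trans_eq ?_
    rw [mul_right_comm, ← ENNReal.ofReal_mul (by positivity)]
    congr 2
    have h4 : (4 : ℝ) ^ k = 2 ^ (2 * (k : ℝ)) := by
      rw [Real.rpow_mul (by norm_num), Real.rpow_natCast]
      norm_num
    rw [Real.div_rpow (by positivity) (by positivity), Real.mul_rpow (by norm_num) (by positivity),
      neg_div, Real.rpow_neg (by positivity), h4, ← Real.rpow_mul (by norm_num),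
      show 2 * (k : ℝ) * (θ / 2) = θ * k by ring]
    have e1 : (4 : ℝ) ^ (θ / 2) ≠ 0 := by positivity
    field_simp
  · have h0 : ∀ m, blockKernel k m n = 0 := fun m => by
      by_contra h'
      exact h (of_blockKernel_ne_zero h').2
    simp [h0]

/-! ### The error bound -/

theorem mixNorm_eq {d : ℕ} (s : ℝ) (f : Torus d → ℂ) :
    mixNorm s f = (∑' k : Fin d → ℤ, ‖coeff f k‖ₑ ^ 2 *
      ∏ j, ENNReal.ofReal ((1 + (k j : ℝ) ^ 2) ^ s)) ^ (1 / 2 : ℝ) := by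
  unfold mixNorm
  congr 1
  refine tsum_congr fun k => ?_
  rw [ENNReal.ofReal_mul (by positivity), ENNReal.ofReal_pow (norm_nonneg _), ofReal_norm,
    ENNReal.ofReal_prod_of_nonneg fun _ _ => by positivity]

/-- Functions of mixed smoothness above `1 / 2` have absolutely summable Fourier coefficients. -/
theorem summable_norm_coeff {d : ℕ} {α : ℝ} (hα : 1 / 2 < α) {f : Torus d → ℂ}
    (hf : mixNorm α f < ⊤) : Summable fun n => ‖coeff f n‖ := by
  rw [mixNorm_eq, ENNReal.rpow_lt_top_iff_of_pos (by norm_num)] at hf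
  -- The dual weight `(1 + n²)^{-α}` is summable because `2α > 1`; the exponent is written to match
  -- `bracketSum (2 * α)`.
  have h1 := sq_tsum_le (T := fun n => ‖coeff f n‖ₑ)
    (U := fun n => ‖coeff f n‖ₑ ^ 2 * ∏ j, ENNReal.ofReal ((1 + (n j : ℝ) ^ 2) ^ α))
    (V := fun n => ∏ j, ENNReal.ofReal ((1 + (n j : ℝ) ^ 2) ^ (-(2 * α) / 2))) fun n => by
      rw [mul_assoc, ← Finset.prod_mul_distrib]
      refine le_of_eq ?_
      rw [Finset.prod_eq_one, mul_one]
      intro j _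
      rw [← ENNReal.ofReal_mul (by positivity), ← Real.rpow_add (by positivity)]
      ring_nf
      simp
  have h2 : ∑' n : Fin d → ℤ, ∏ j, ENNReal.ofReal ((1 + (n j : ℝ) ^ 2) ^ (-(2 * α) / 2))
      = bracketSum (2 * α) ^ d := by
    rw [tsum_pi_prod fun _ (l : ℤ) => ENNReal.ofReal ((1 + (l : ℝ) ^ 2) ^ (-(2 * α) / 2))]
    simp [bracketSum]
  rw [h2] at h1
  have h3 : ∑' n, ‖coeff f n‖ₑ ≠ ⊤ := by
    intro h
    rw [h] at h1
    refine absurd (top_le_iff.1 ((by simp : (⊤ : ENNReal) = ⊤ ^ 2).trans_le h1)) ?_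
    exact ENNReal.mul_ne_top hf.ne (ENNReal.pow_ne_top (bracketSum_ne_top (by linarith)))
  have h4 : Summable fun n => ‖coeff f n‖₊ := ENNReal.tsum_coe_ne_top_iff_summable.1 h3
  exact NNReal.summable_coe.2 h4

theorem exists_mixNorm_error_le (d : ℕ) {α γ : ℝ} (hγ : 0 < γ) (hγα : γ < α) (hα : 1 / 2 < α) :
    ∃ K : ℝ, 0 < K ∧ ∀ f : Torus d → ℂ, MemMix α f → ∀ ξ : ℝ,
      mixNorm γ (f - samplingOp (smolyakSet d α γ ξ) fun x => ∑' n, coeff f n * expo n x)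
        ≤ ENNReal.ofReal (K * 2 ^ (-ξ)) * mixNorm α f := by
  -- The Schur weights need `β > 1`, `θ > 0` and `β + θ = 2α`, so that the powers of `1 + n²` cancel
  -- and those of 2 give `2^{2(α-γ)k}`. The choice `α ± 1/2` works because `α > 1/2`.
  obtain ⟨A, hA, hA'⟩ := exists_tsum_tsum_weight_le (β := α + 1 / 2) (by linarith) hγ
  obtain ⟨B, hB, hB'⟩ := exists_tsum_tsum_enorm_blockKernel_le (θ := α - 1 / 2) (by linarith)
  have hD : A ^ d * B ^ d ≠ ⊤ := ENNReal.mul_ne_top (ENNReal.pow_ne_top hA) (ENNReal.pow_ne_top hB)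
  -- The added 1 only makes the constant positive.
  refine ⟨Real.sqrt ((A ^ d * B ^ d).toReal + 1), by positivity, fun f hf ξ => ?_⟩
  have hschur := tensor_schur_test (d := d)
    (t := fun (k : ℕ) (m n : ℤ) => ENNReal.ofReal (2 ^ ((α - γ) * k)) * ‖blockKernel k m n‖ₑ)
    (w := fun m => ENNReal.ofReal ((1 + (m : ℝ) ^ 2) ^ γ))
    (z := fun n => ENNReal.ofReal ((1 + (n : ℝ) ^ 2) ^ α))
    (fun k m n => by
      refine le_of_eq ?_
      have hm : (0 : ℝ) < 1 + (m : ℝ) ^ 2 := by positivity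
      have hn : (0 : ℝ) < 1 + (n : ℝ) ^ 2 := by positivity
      have e1 : ((1 + (m : ℝ) ^ 2) ^ γ * 2 ^ ((α + 1 / 2 - 2 * γ) * k) *
          (1 + (n : ℝ) ^ 2) ^ (-(α + 1 / 2) / 2)) *
          ((2 ^ ((α - 1 / 2) * k) * (1 + (n : ℝ) ^ 2) ^ (-(α - 1 / 2) / 2)) *
            (1 + (n : ℝ) ^ 2) ^ α)
          = ((2 : ℝ) ^ ((α - γ) * k)) ^ 2 * (1 + (m : ℝ) ^ 2) ^ γ := by
        have e2 : (1 + (n : ℝ) ^ 2) ^ (-(α + 1 / 2) / 2) *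
            ((1 + (n : ℝ) ^ 2) ^ (-(α - 1 / 2) / 2) * (1 + (n : ℝ) ^ 2) ^ α) = 1 := by
          rw [← Real.rpow_add hn, ← Real.rpow_add hn]
          ring_nf
          simp
        have e3 : (2 : ℝ) ^ ((α + 1 / 2 - 2 * γ) * k) * 2 ^ ((α - 1 / 2) * k)
            = ((2 : ℝ) ^ ((α - γ) * k)) ^ 2 := by
          rw [← Real.rpow_add two_pos, ← Real.rpow_natCast, ← Real.rpow_mul two_pos.le]
          congr 1
          push_cast
          ring
        rw [← e3]
        linear_combination ((1 + (m : ℝ) ^ 2) ^ γ * (2 : ℝ) ^ ((α + 1 / 2 - 2 * γ) * k) *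
          2 ^ ((α - 1 / 2) * k)) * e2
      have e4 := congrArg ENNReal.ofReal e1
      rw [ENNReal.ofReal_mul (by positivity),
        ENNReal.ofReal_mul (q := (1 + (n : ℝ) ^ 2) ^ α) (by positivity),
        ENNReal.ofReal_mul (p := ((2 : ℝ) ^ ((α - γ) * k)) ^ 2) (by positivity),
        ENNReal.ofReal_pow (by positivity)] at e4
      rw [mul_pow, mul_right_comm, ← e4]
      ring) hA' hB' (fun n => ‖coeff f n‖ₑ)
  rw [Real.sqrt_eq_rpow, mixNorm_eq, mixNorm_eq, ← Real.sqrt_eq_rpow]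
  refine rpow_half_le (by positivity) ?_
  have hK : ENNReal.ofReal ((Real.sqrt ((A ^ d * B ^ d).toReal + 1) * 2 ^ (-ξ)) ^ 2)
      = ENNReal.ofReal (2 ^ (-ξ)) ^ 2 * (A ^ d * B ^ d + 1) := by
    rw [mul_pow, Real.sq_sqrt (by positivity), mul_comm, ENNReal.ofReal_mul (by positivity),
      ENNReal.ofReal_pow (by positivity), ENNReal.ofReal_add (by positivity) (by norm_num),
      ENNReal.ofReal_toReal hD, ENNReal.ofReal_one]
  rw [hK, mul_assoc]
  have hs := summable_norm_coeff hα hf.2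
  have hint : Integrable f := hf.1.integrable (by norm_num)
  refine le_trans (ENNReal.tsum_le_tsum fun m => mul_le_mul_left
    (pow_le_pow_left₀ zero_le (enorm_coeff_sub_samplingOp_le hγα ξ hint hs m) 2) _) ?_
  simp only [mul_pow (ENNReal.ofReal _), mul_assoc (ENNReal.ofReal _ ^ 2)]
  rw [ENNReal.tsum_mul_left]
  gcongr
  refine hschur.trans ?_
  gcongr
  exact le_self_add

end SmolyakSampling
end

theorem theorem5 (d : ℕ) (α γ : ℝ) (hγ : 0 < γ) (hα : max γ (1 / 2) < α) :
    ∃ C : ℝ, 0 < C ∧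
      ∀ f : SmolyakSampling.Torus d → ℂ, SmolyakSampling.MemMix α f →
        ∃ g : SmolyakSampling.Torus d → ℂ, Continuous g ∧ g =ᵐ[volume] f ∧
          ∀ ξ : ℝ, 0 < ξ →
            SmolyakSampling.MemMix γ
              (f - SmolyakSampling.samplingOp (SmolyakSampling.smolyakSet d α γ ξ) g) ∧
            SmolyakSampling.mixNorm γ
                (f - SmolyakSampling.samplingOp (SmolyakSampling.smolyakSet d α γ ξ) g) ≤
              ENNReal.ofReal (C * 2 ^ (-ξ)) * SmolyakSampling.mixNorm α f ∧
            SmolyakSampling.mixNormLP γ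
                (f - SmolyakSampling.samplingOp (SmolyakSampling.smolyakSet d α γ ξ) g) ≤
              ENNReal.ofReal (C * 2 ^ (-ξ)) * SmolyakSampling.mixNormLP α f := by
  open SmolyakSampling in
  obtain ⟨hγα, hα⟩ := max_lt_iff.1 hα
  obtain ⟨K, hK, hKf⟩ := exists_mixNorm_error_le d hγ hγα hα
  obtain ⟨K₁, hK₁, hK₁f⟩ := exists_mixNormLP_le d hγ.le
  obtain ⟨K₂, hK₂, hK₂f⟩ := exists_mixNorm_le d (hγ.trans hγα).le
  -- `K` serves the coefficient norms; `K₁ * K * K₂` serves the Littlewood–Paley norms, with `K₁`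
  -- converting at smoothness `γ` and `K₂` at `α`.
  refine ⟨K + K₁ * K * K₂, by positivity, fun f hf => ?_⟩
  have hs := summable_norm_coeff hα hf.2
  refine ⟨fun x => ∑' n, coeff f n * expo n x, continuous_tsum_expo hs, tsum_expo_ae_eq hf.1 hs,
    fun ξ _ => ?_⟩
  have h := hKf f hf ξ
  have hQ := continuous_samplingOp_tsum_expo hs (smolyakSet_finite d hγα ξ)
  refine ⟨⟨hf.1.sub (hQ.memLp_of_hasCompactSupport (HasCompactSupport.of_compactSpace _)),
    h.trans_lt (ENNReal.mul_lt_top ENNReal.ofReal_lt_top hf.2)⟩, h.trans ?_, ?_⟩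
  · gcongr
    exact le_add_of_nonneg_right (by positivity)
  · refine (hK₁f _).trans ((mul_le_mul_right (h.trans
      (mul_le_mul_right (hK₂f f) _)) _).trans ?_)
    rw [← mul_assoc, ← mul_assoc, ← ENNReal.ofReal_mul (by positivity),
      ← ENNReal.ofReal_mul (by positivity)]
    refine mul_le_mul_left (ENNReal.ofReal_le_ofReal ?_) _
    have : 0 ≤ K * (2 : ℝ) ^ (-ξ) := by positivity
    nlinarith
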